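/- **Setting.** An LSTM network with weight matrices $W_g,W_r,W_o,W_c\in\mathbb R^{d_h\times d_x}$, $U_g,U_r,U_o,U_c\in\mathbb R^{d_h\times d_h}$, $V\in\mathbb R^{K\times d_h}$ ($K\ge 2$ classes, $d_y=K$) maps inputs $x_1,\dots,x_t\in\mathbb R^{d_x}$ to $y_t$ by $h_0=c_0=0$ and, for $j\ge 1$, $$g_j=\sigma(W_gx_j+U_gh_{j-1}),\quad r_j=\sigma(W_rx_j+U_rh_{j-1}),\quad o_j=\sigma(W_ox_j+U_oh_{j-1}),\quad \tilde c_j=\tanh(W_cx_j+U_ch_{j-1}),$$ $$c_j=g_j\odot c_{j-1}+r_j\odot\tilde c_j,\qquad h_j=o_j\odot\tanh(c_j),\qquad y_t=\sigma_y(Vh_t),$$ where $\sigma(a)=(1+e^{-a})^{-1}$, all activations act entrywise, $\sigma_y:\mathbb R\to\mathbb R$ is $\rho_y$-Lipschitz and $\sigma_y(0)=0$. Given numbers $B_{W_g},\dots,B_{U_c},B_V$, let $\mathcal F_{g,t}$ be the class of all maps $f_t:X_t=(x_1,\dots,x_t)\mapsto y_t$ computed by networks whose weight matrices have spectral norms at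 most $B_{W_g},B_{W_r},B_{W_o},B_{W_c},B_{U_g},B_{U_r},B_{U_o},B_{U_c},B_V$ respectively. Let $\phi$ be any choice of $\arg\max_k[y]_k$, $\tilde z_t=\phi(y_t)$, $\mathcal M(y,z)=[y]_z-\max_{k\ne z}[y]_k$, $\mathcal L_\gamma(a)=\mathbf 1\{a>0\}+(1+a/\gamma)\mathbf 1\{-\gamma\le a\le 0\}$, and, for a sample $S$ of $m$ sequences, $\hat{\mathcal R}_\gamma(f_t)=\frac1m\sum_{i=1}^m\mathcal L_\gamma(-\mathcal M(f_t(X_{i,t}),z_{i,t}))$. Put $\frac{a^t-1}{a-1}=t$ for $a=1$, and $d=\max\{d_x,d_y,d_h\}$. For a network and a bound $B_x$ on the inputs, write $\|g_j\|_\infty$ for the supremum of the entries of $|g_j|$ over all input sequences with $\|x_i\|_2\le B_x$, similarly $\|r_j\|_\infty,\|o_j\|_\infty$, and let $$\beta=\max_{1\le j\le t}\{\|g_j\|_\infty+B_{U_c}\|r_j\|_\infty\|o_j\|_\infty\},\qquad \theta=\beta+B_{U_g}+B_{U_r}+B_{U_o},$$ $$\mathcal E=\frac{d\,\rho_yB_V\min\big\{\sqrt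 d,\;B_{W_c}B_x\frac{\beta^t-1}{\beta-1}\big\}\sqrt{\log\big(\frac{\theta^t-1}{\theta-1}\,d\sqrt m\big)}}{\sqrt m\,\gamma}.$$ **Theorem.** There is an absolute constant $C>0$, and for all norm bounds $B_{W_g},\dots,B_{U_c},B_V$, all $B_x$, $\rho_y$ and every $t\ge 1$ there are a constant $C'$ and a number $m_0$, depending only on these, such that the following holds for all $d_x,d_h$, $K\ge 2$, $T\ge t$, all $\sigma_y$ and $\phi$ as above, every $m\ge 1$ and every $\delta\in(0,1)$. Let a test sequence $(x_s,z_s)_{s=1}^T$ and the sequences of $S=\{(x_{i,s},z_{i,s})_{s=1}^T\}_{i=1}^m$ be drawn i.i.d. from any distribution on sequences in $\mathbb R^{d_x}\times\{1,\dots,K\}$ with $\|x_s\|_2\le B_x$ almost surely for all $s$. Then with probability at least $1-\delta$ over $S$, for every $\gamma>0$ and every $f_t\in\mathcal F_{g,t}$, $$\mathbb P(\tilde z_t\ne z_t)\le\hat{\mathcal R}_\gamma(f_t)+3\sqrt{\frac{\log\frac2\delta}{2m}}+C'\,\mathcal E,$$ and, if moreover $m\ge m_0$, the same inequality holds with the absolute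 constant $C$ in place of $C'$. -/

import Mathlib

open MeasureTheory
open scoped NNReal Matrix.Norms.L2Operator

noncomputable section

/-- Entrywise action of a scalar activation on a vector. -/
def entrywise {n : ℕ} (a : ℝ → ℝ) (v : EuclideanSpace ℝ (Fin n)) : EuclideanSpace ℝ (Fin n) :=
  WithLp.toLp 2 fun i => a (v i)

/-- Entrywise (Hadamard) product of vectors. -/
def hadamard {n : ℕ} (u v : EuclideanSpace ℝ (Fin n)) : EuclideanSpace ℝ (Fin n) :=
  WithLp.toLp 2 fun i => u i * v i

/-- The infinity norm of a vector, `max_i |v_i|` (and `0` for the empty vector). -/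
def vecInfNorm {n : ℕ} (v : EuclideanSpace ℝ (Fin n)) : ℝ := ⨆ i : Fin n, |v i|

/-- The number `(a ^ t - 1) / (a - 1)`, read as `t` when `a = 1`. -/
def geomRatio (a : ℝ) (t : ℕ) : ℝ := if a = 1 then (t : ℝ) else (a ^ t - 1) / (a - 1)

/-- Weight matrices of an LSTM network with input dimension `dx`, hidden dimension `dh` and
output dimension `dy`. -/
structure LSTMWeights (dx dh dy : ℕ) where
  Wg : Matrix (Fin dh) (Fin dx) ℝ
  Wr : Matrix (Fin dh) (Fin dx) ℝ
  Wo : Matrix (Fin dh) (Fin dx) ℝ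
  Wc : Matrix (Fin dh) (Fin dx) ℝ
  Ug : Matrix (Fin dh) (Fin dh) ℝ
  Ur : Matrix (Fin dh) (Fin dh) ℝ
  Uo : Matrix (Fin dh) (Fin dh) ℝ
  Uc : Matrix (Fin dh) (Fin dh) ℝ
  V : Matrix (Fin dy) (Fin dh) ℝ

/-- Upper bounds for the spectral norms of the weight matrices. -/
structure LSTMNormBounds where
  Wg : ℝ
  Wr : ℝ
  Wo : ℝ
  Wc : ℝ
  Ug : ℝ
  Ur : ℝ
  Uo : ℝ
  Uc : ℝ
  V : ℝ

/-- The weights whose spectral norms (the norm on matrices here is the operator norm with respect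
to Euclidean norms) obey the bounds `B`. -/
def lstmClass (B : LSTMNormBounds) (dx dh dy : ℕ) : Set (LSTMWeights dx dh dy) :=
  {w | ‖w.Wg‖ ≤ B.Wg ∧ ‖w.Wr‖ ≤ B.Wr ∧ ‖w.Wo‖ ≤ B.Wo ∧ ‖w.Wc‖ ≤ B.Wc ∧
    ‖w.Ug‖ ≤ B.Ug ∧ ‖w.Ur‖ ≤ B.Ur ∧ ‖w.Uo‖ ≤ B.Uo ∧ ‖w.Uc‖ ≤ B.Uc ∧ ‖w.V‖ ≤ B.V}

/-- The layer `a (W x + U h)` with activation `a`. -/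
def lstmLayer {dx dh : ℕ} (a : ℝ → ℝ) (W : Matrix (Fin dh) (Fin dx) ℝ)
    (U : Matrix (Fin dh) (Fin dh) ℝ) (x : EuclideanSpace ℝ (Fin dx))
    (h : EuclideanSpace ℝ (Fin dh)) : EuclideanSpace ℝ (Fin dh) :=
  entrywise a (Matrix.toEuclideanLin W x + Matrix.toEuclideanLin U h)

/-- One LSTM step: from the state `(c_{t-1}, h_{t-1})` and the input `x_t` to `(c_t, h_t)`. -/
def lstmStep {dx dh dy : ℕ} (w : LSTMWeights dx dh dy)
    (s : EuclideanSpace ℝ (Fin dh) × EuclideanSpace ℝ (Fin dh)) (x : EuclideanSpace ℝ (Fin dx)) :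
    EuclideanSpace ℝ (Fin dh) × EuclideanSpace ℝ (Fin dh) :=
  let g := lstmLayer Real.sigmoid w.Wg w.Ug x s.2
  let r := lstmLayer Real.sigmoid w.Wr w.Ur x s.2
  let o := lstmLayer Real.sigmoid w.Wo w.Uo x s.2
  let ctil := lstmLayer Real.tanh w.Wc w.Uc x s.2
  let c := hadamard g s.1 + hadamard r ctil
  (c, hadamard o (entrywise Real.tanh c))

/-- The state `(c_n, h_n)` after the inputs `X = (x_1, …, x_n)`, started at `c_0 = h_0 = 0`. -/
def lstmState {dx dh dy : ℕ} (w : LSTMWeights dx dh dy) :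
    (n : ℕ) → (Fin n → EuclideanSpace ℝ (Fin dx)) →
      EuclideanSpace ℝ (Fin dh) × EuclideanSpace ℝ (Fin dh)
  | 0, _ => (0, 0)
  | n + 1, X => lstmStep w (lstmState w n (fun i => X i.castSucc)) (X (Fin.last n))

/-- The output `y_t = σy (V h_t)` after the inputs `X = (x_1, …, x_t)`. -/
def lstmOutput {dx dh dy : ℕ} (σy : ℝ → ℝ) (w : LSTMWeights dx dh dy) (t : ℕ)
    (X : Fin t → EuclideanSpace ℝ (Fin dx)) : EuclideanSpace ℝ (Fin dy) :=
  entrywise σy (Matrix.toEuclideanLin w.V (lstmState w t X).2)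

/-- The gate `g_{n+1}` as a function of the inputs `x_1, …, x_{n+1}`. -/
def gateG {dx dh dy : ℕ} (w : LSTMWeights dx dh dy) (n : ℕ)
    (X : Fin (n + 1) → EuclideanSpace ℝ (Fin dx)) : EuclideanSpace ℝ (Fin dh) :=
  lstmLayer Real.sigmoid w.Wg w.Ug (X (Fin.last n)) (lstmState w n fun i => X i.castSucc).2

/-- The gate `r_{n+1}` as a function of the inputs `x_1, …, x_{n+1}`. -/
def gateR {dx dh dy : ℕ} (w : LSTMWeights dx dh dy) (n : ℕ)
    (X : Fin (n + 1) → EuclideanSpace ℝ (Fin dx)) : EuclideanSpace ℝ (Fin dh) :=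
  lstmLayer Real.sigmoid w.Wr w.Ur (X (Fin.last n)) (lstmState w n fun i => X i.castSucc).2

/-- The gate `o_{n+1}` as a function of the inputs `x_1, …, x_{n+1}`. -/
def gateO {dx dh dy : ℕ} (w : LSTMWeights dx dh dy) (n : ℕ)
    (X : Fin (n + 1) → EuclideanSpace ℝ (Fin dx)) : EuclideanSpace ℝ (Fin dh) :=
  lstmLayer Real.sigmoid w.Wo w.Uo (X (Fin.last n)) (lstmState w n fun i => X i.castSucc).2

/-- The function infinity norm of a vector-valued function `G` of `n` inputs: the supremum of
`‖G X‖_∞` over all input sequences `X` with `‖x_i‖₂ ≤ Bx`. -/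
def funInfNorm {n dx dh : ℕ} (Bx : ℝ)
    (G : (Fin n → EuclideanSpace ℝ (Fin dx)) → EuclideanSpace ℝ (Fin dh)) : ℝ :=
  sSup {a | ∃ X : Fin n → EuclideanSpace ℝ (Fin dx), (∀ i, ‖X i‖ ≤ Bx) ∧ a = vecInfNorm (G X)}

/-- `β = max_{1 ≤ j ≤ t} (‖g_j‖_∞ + B_{U_c} ‖r_j‖_∞ ‖o_j‖_∞)` for the network with weights `w`. -/
def lstmBeta {dx dh dy : ℕ} (B : LSTMNormBounds) (Bx : ℝ) (t : ℕ)
    (w : LSTMWeights dx dh dy) : ℝ :=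
  ⨆ n : Fin t, (funInfNorm Bx (gateG w n) +
    B.Uc * funInfNorm Bx (gateR w n) * funInfNorm Bx (gateO w n))

/-- `θ = β + B_{U_g} + B_{U_r} + B_{U_o}`. -/
def lstmTheta {dx dh dy : ℕ} (B : LSTMNormBounds) (Bx : ℝ) (t : ℕ)
    (w : LSTMWeights dx dh dy) : ℝ :=
  lstmBeta B Bx t w + B.Ug + B.Ur + B.Uo

/-- The functional margin `y_z - max_{j ≠ z} y_j`. -/
def margin {K : ℕ} (y : EuclideanSpace ℝ (Fin K)) (z : Fin K) : ℝ :=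
  y z - ⨆ j : {j : Fin K // j ≠ z}, y j

/-- The ramp loss `1{a > 0} + (1 + a / γ) 1{-γ ≤ a ≤ 0}`. -/
def rampLoss (γ a : ℝ) : ℝ :=
  (if 0 < a then 1 else 0) + (if -γ ≤ a ∧ a ≤ 0 then 1 + a / γ else 0)

/-- A sequence `(x_t, z_t)_{t=1}^T` of inputs and labels; index `i : Fin T` is time `i + 1`. -/
abbrev LabeledSeq (dx K T : ℕ) : Type := Fin T → EuclideanSpace ℝ (Fin dx) × Fin K

/-- The inputs `X_t = (x_1, …, x_t)` of a sequence. -/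
def inputPrefix {dx K T : ℕ} (t : ℕ) (ht : t ≤ T) (p : LabeledSeq dx K T) :
    Fin t → EuclideanSpace ℝ (Fin dx) :=
  fun i => (p (Fin.castLE ht i)).1

/-- The label `z_t` of a sequence, for `1 ≤ t ≤ T`. -/
def labelAt {dx K T : ℕ} (t : ℕ) (ht1 : 1 ≤ t) (ht : t ≤ T) (p : LabeledSeq dx K T) : Fin K :=
  (p ⟨t - 1, by omega⟩).2

/-- The misclassification probability `P(φ(y_t) ≠ z_t)` of the network with weights `w`, for a
test sequence with law `D`. -/
def misclassProb {dx dh K T : ℕ} (σy : ℝ → ℝ) (φ : EuclideanSpace ℝ (Fin K) → Fin K) (t : ℕ)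
    (ht1 : 1 ≤ t) (ht : t ≤ T) (D : Measure (LabeledSeq dx K T)) (w : LSTMWeights dx dh K) : ℝ :=
  D.real {p | φ (lstmOutput σy w t (inputPrefix t ht p)) ≠ labelAt t ht1 ht p}

/-- The empirical ramp risk of the network with weights `w` on the sample `S`. -/
def empRampRisk {dx dh K T m : ℕ} (σy : ℝ → ℝ) (γ : ℝ) (t : ℕ) (ht1 : 1 ≤ t) (ht : t ≤ T)
    (S : Fin m → LabeledSeq dx K T) (w : LSTMWeights dx dh K) : ℝ :=
  (1 / (m : ℝ)) * ∑ i : Fin m,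
    rampLoss γ (-margin (lstmOutput σy w t (inputPrefix t ht (S i))) (labelAt t ht1 ht (S i)))

/-- The quantity inside the `O`, for the network with weights `w`. -/
def lstmRate {dx dh K : ℕ} (B : LSTMNormBounds) (Bx ρy : ℝ) (t m : ℕ) (γ : ℝ)
    (w : LSTMWeights dx dh K) : ℝ :=
  let d : ℝ := ((max dx (max K dh) : ℕ) : ℝ)
  d * ρy * B.V * min (√d) (B.Wc * Bx * geomRatio (lstmBeta B Bx t w) t) *
      √(Real.log (geomRatio (lstmTheta B Bx t w) t * d * √(m : ℝ))) /
    (√(m : ℝ) * γ)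

end

noncomputable section

/-! ### Vectors, matrices and activations -/

/-! The ramp loss at `-a` is `1 - min γ a⁺ / γ`, so the empirical risk is one minus the mean of a
clipped margin, divided by `γ`. A misclassified point has margin at most `0`, so the
misclassification probability is at most one minus the expectation of the same clipped margin over
`γ` (`rampLoss_neg`, `misclassProb_le`, `empRampRisk_eq`). It remains to bound how far the empirical
mean of a clipped margin exceeds its expectation, uniformly over weights and clipping levels. No
Rademacher complexity or chaining is needed: Hoeffding and a union bound over a finite cover suffice
(`uniform_deviation`).

The class has at most `10 d ^ 2` real parameters, the clipping level being one of them; this gives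
all `γ` at once. For fixed `t` the network is Lipschitz in its weights
(`exists_lipschitz_lstmState`), so a grid of parameters yields a sup-norm cover of cardinality `(k₀
d ^ 2 √m) ^ (10 d ^ 2)` (`exists_clippedMargin_cover`). Its logarithm is of order `d ^ 2 log (d
√m)`, whence the factor `d √log / √m`. The ratio in `θ` is at least `1` and only enlarges the
logarithm.

The remaining factor is the range of the individual function. The recursion gives `‖c_j‖ ≤ β
‖c_{j-1}‖ + B_{W_c} B_x`, and entries of `h_t` are at most `1`, so a margin is at most `2 ρ_y B_V
min (√d) (...)` (`norm_hidden_le`, `abs_margin_lstmOutput_le`). Since `β` depends on the network,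
Hoeffding is applied with a range attached to each function.

The norm bounds enter the cover only through `log k₀`. This goes into `C'`, and is dominated by `log
(d √m)` once `k₀ ≤ √m`, which leaves an absolute constant (`log_cover_le`). If `ρ_y`, `B_V` or
`B_{W_c} B_x` vanishes, all margins are `0`, the empirical risk is `1`, and the claim is trivial. -/

lemma euclidean_norm_le_of_abs_le {n : ℕ} {a : ℝ} (ha : 0 ≤ a) {u v : EuclideanSpace ℝ (Fin n)}
    (h : ∀ i, |u i| ≤ a * |v i|) : ‖u‖ ≤ a * ‖v‖ := by
  rw [EuclideanSpace.norm_eq, EuclideanSpace.norm_eq, ← Real.sqrt_sq ha,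
    ← Real.sqrt_mul (sq_nonneg a), Finset.mul_sum]
  apply Real.sqrt_le_sqrt
  apply Finset.sum_le_sum
  intro i _
  rw [← mul_pow, Real.norm_eq_abs, Real.norm_eq_abs]
  exact pow_le_pow_left₀ (abs_nonneg _) (h i) 2

lemma euclidean_norm_le_sqrt {n : ℕ} {u : EuclideanSpace ℝ (Fin n)}
    (h : ∀ i, |u i| ≤ 1) : ‖u‖ ≤ √(n : ℝ) := by
  rw [EuclideanSpace.norm_eq]
  apply Real.sqrt_le_sqrt
  calc ∑ i, ‖u i‖ ^ 2 ≤ ∑ _i : Fin n, (1 : ℝ) := by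
        apply Finset.sum_le_sum
        intro i _
        rw [Real.norm_eq_abs]
        exact pow_le_one₀ (abs_nonneg _) (h i)
    _ = n := by simp

lemma abs_apply_le_norm {n : ℕ} (u : EuclideanSpace ℝ (Fin n)) (i : Fin n) : |u i| ≤ ‖u‖ := by
  simpa using PiLp.norm_apply_le u i

lemma norm_hadamard_le {n : ℕ} {a : ℝ} (ha : 0 ≤ a) {u : EuclideanSpace ℝ (Fin n)}
    (h : ∀ i, |u i| ≤ a) (v : EuclideanSpace ℝ (Fin n)) : ‖hadamard u v‖ ≤ a * ‖v‖ := by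
  apply euclidean_norm_le_of_abs_le ha
  intro i
  simp only [hadamard, abs_mul]
  exact mul_le_mul_of_nonneg_right (h i) (abs_nonneg _)

/-- Perturbation of a Hadamard product. -/
lemma norm_hadamard_sub_hadamard_le {n : ℕ} {a b : ℝ} (ha : 0 ≤ a) (hb : 0 ≤ b)
    {u u' v v' : EuclideanSpace ℝ (Fin n)} (hu : ∀ i, |u i| ≤ a) (hv : ∀ i, |v' i| ≤ b) :
    ‖hadamard u v - hadamard u' v'‖ ≤ a * ‖v - v'‖ + b * ‖u - u'‖ := by
  have h : hadamard u v - hadamard u' v' = hadamard u (v - v') + hadamard v' (u - u') := by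
    ext i
    simp [hadamard]
    ring
  rw [h]
  exact (norm_add_le _ _).trans (add_le_add (norm_hadamard_le ha hu _) (norm_hadamard_le hb hv _))

lemma norm_entrywise_sub_le {n : ℕ} {a : ℝ → ℝ} {k : ℝ} (hk : 0 ≤ k)
    (ha : ∀ x y, |a x - a y| ≤ k * |x - y|) (u v : EuclideanSpace ℝ (Fin n)) :
    ‖entrywise a u - entrywise a v‖ ≤ k * ‖u - v‖ := by
  apply euclidean_norm_le_of_abs_le hk
  intro i
  simpa [entrywise] using ha (u i) (v i)

lemma norm_entrywise_le {n : ℕ} {a : ℝ → ℝ} {k : ℝ} (hk : 0 ≤ k)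
    (ha : ∀ x y, |a x - a y| ≤ k * |x - y|) (h0 : a 0 = 0) (u : EuclideanSpace ℝ (Fin n)) :
    ‖entrywise a u‖ ≤ k * ‖u‖ := by
  have h := norm_entrywise_sub_le hk ha u 0
  have h2 : entrywise a (0 : EuclideanSpace ℝ (Fin n)) = 0 := by
    ext i
    simp [entrywise, h0]
  simpa [h2] using h

lemma continuous_entrywise {n : ℕ} {a : ℝ → ℝ} (ha : Continuous a) :
    Continuous (entrywise a : EuclideanSpace ℝ (Fin n) → EuclideanSpace ℝ (Fin n)) := by
  unfold entrywise
  fun_prop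

lemma continuous_hadamard {α : Type*} [TopologicalSpace α] {n : ℕ}
    {f g : α → EuclideanSpace ℝ (Fin n)}
    (hf : Continuous f) (hg : Continuous g) : Continuous fun x => hadamard (f x) (g x) := by
  unfold hadamard
  fun_prop

lemma norm_toEuclideanLin_le {m n : ℕ} (A : Matrix (Fin m) (Fin n) ℝ)
    (x : EuclideanSpace ℝ (Fin n)) : ‖Matrix.toEuclideanLin A x‖ ≤ ‖A‖ * ‖x‖ :=
  Matrix.l2_opNorm_mulVec A x

lemma abs_entry_le_norm {m n : ℕ} (A : Matrix (Fin m) (Fin n) ℝ) (i : Fin m) (j : Fin n) :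
    |A i j| ≤ ‖A‖ := by
  have h := norm_toEuclideanLin_le A (EuclideanSpace.single j 1)
  have h2 := abs_apply_le_norm (Matrix.toEuclideanLin A (EuclideanSpace.single j 1)) i
  simp [Matrix.toLpLin_apply] at h h2
  exact h2.trans h

/-- The spectral norm is at most the dimension times the largest entry. -/
lemma norm_le_of_abs_entry_le {m n d : ℕ} (hm : m ≤ d) (hn : n ≤ d) {η : ℝ} (hη : 0 ≤ η)
    {A : Matrix (Fin m) (Fin n) ℝ} (h : ∀ i j, |A i j| ≤ η) : ‖A‖ ≤ d * η := by
  rw [Matrix.l2_opNorm_def]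
  refine ContinuousLinearMap.opNorm_le_bound _ (by positivity) fun x => ?_
  have hsum : ∑ j, |x j| ≤ √(n : ℝ) * ‖x‖ := by
    have h1 := Finset.sum_mul_sq_le_sq_mul_sq Finset.univ (fun _ : Fin n => (1 : ℝ))
      fun j => |x j|
    rw [← Real.sqrt_sq (norm_nonneg x), ← Real.sqrt_mul (Nat.cast_nonneg n),
      EuclideanSpace.norm_sq_eq]
    apply Real.le_sqrt_of_sq_le
    simpa using h1
  have hent : ∀ i, |(Matrix.toEuclideanLin A x) i| ≤ (η * (√(n : ℝ) * ‖x‖)) * |(1 : ℝ)| := by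
    intro i
    simp only [Matrix.toLpLin_apply, Matrix.mulVec, dotProduct, abs_one, mul_one]
    refine (Finset.abs_sum_le_sum_abs _ _).trans ?_
    refine le_trans ?_ (mul_le_mul_of_nonneg_left hsum hη)
    rw [Finset.mul_sum]
    apply Finset.sum_le_sum
    intro j _
    rw [abs_mul]
    exact mul_le_mul_of_nonneg_right (h i j) (abs_nonneg _)
  have h2 : ‖Matrix.toEuclideanLin A x‖ ≤
      (η * (√(n : ℝ) * ‖x‖)) * ‖(WithLp.toLp 2 fun _ => 1 : EuclideanSpace ℝ (Fin m))‖ :=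
    euclidean_norm_le_of_abs_le (by positivity) hent
  have h3 : ‖(WithLp.toLp 2 fun _ => 1 : EuclideanSpace ℝ (Fin m))‖ ≤ √(m : ℝ) :=
    euclidean_norm_le_sqrt (by simp)
  have hm' : √(m : ℝ) ≤ √(d : ℝ) := Real.sqrt_le_sqrt (by exact_mod_cast hm)
  have hn' : √(n : ℝ) ≤ √(d : ℝ) := Real.sqrt_le_sqrt (by exact_mod_cast hn)
  calc ‖Matrix.toEuclideanLin A x‖ ≤ _ := h2
    _ ≤ (η * (√(d : ℝ) * ‖x‖)) * √(d : ℝ) := by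
        gcongr
        exact h3.trans hm'
    _ = (√(d : ℝ) * √(d : ℝ)) * η * ‖x‖ := by ring
    _ = d * η * ‖x‖ := by rw [Real.mul_self_sqrt (Nat.cast_nonneg d)]

/-- The derivative `s (1 - s)` is at most `1 / 4`. The sharp constant matters: through `tanh x = 2
sigmoid (2 x) - 1` it makes `tanh` exactly 1-Lipschitz. -/
lemma abs_sigmoid_sub_le (x y : ℝ) : |Real.sigmoid x - Real.sigmoid y| ≤ 1 / 4 * |x - y| := by
  have h := Convex.norm_image_sub_le_of_norm_deriv_le (f := Real.sigmoid) (C := 1 / 4)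
    (s := Set.univ) (x := y) (y := x) (fun z _ => differentiableAt_sigmoid)
    (fun z _ => by
      rw [Real.deriv_sigmoid, Real.norm_eq_abs, abs_le]
      have h1 := Real.sigmoid_nonneg z
      have h2 := Real.sigmoid_le_one z
      constructor <;> nlinarith [sq_nonneg (Real.sigmoid z - 1 / 2)])
    convex_univ (Set.mem_univ _) (Set.mem_univ _)
  simpa using h

lemma abs_sigmoid_le_one (x : ℝ) : |Real.sigmoid x| ≤ 1 := by
  rw [abs_of_nonneg (Real.sigmoid_nonneg x)]
  exact Real.sigmoid_le_one x

lemma abs_sigmoid_sub_le_one_mul (x y : ℝ) :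
    |Real.sigmoid x - Real.sigmoid y| ≤ 1 * |x - y| :=
  (abs_sigmoid_sub_le x y).trans
    (mul_le_mul_of_nonneg_right (by norm_num) (abs_nonneg _))

lemma tanh_eq_sigmoid (x : ℝ) : Real.tanh x = 2 * Real.sigmoid (2 * x) - 1 := by
  have h : Real.exp (-(2 * x)) = Real.exp (-x) / Real.exp x := by
    rw [← Real.exp_sub]
    ring_nf
  rw [Real.tanh_eq_sinh_div_cosh, Real.sinh_eq, Real.cosh_eq, Real.sigmoid_def, h]
  have := Real.exp_pos x
  have := Real.exp_pos (-x)
  field_simp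
  ring

lemma abs_tanh_le_one (x : ℝ) : |Real.tanh x| ≤ 1 := by
  rw [tanh_eq_sigmoid, abs_le]
  have h1 := Real.sigmoid_nonneg (2 * x)
  have h2 := Real.sigmoid_le_one (2 * x)
  constructor <;> linarith

lemma abs_tanh_sub_le (x y : ℝ) : |Real.tanh x - Real.tanh y| ≤ 1 * |x - y| := by
  have h := abs_sigmoid_sub_le (2 * x) (2 * y)
  rw [tanh_eq_sigmoid, tanh_eq_sigmoid,
    show 2 * Real.sigmoid (2 * x) - 1 - (2 * Real.sigmoid (2 * y) - 1) =
      2 * (Real.sigmoid (2 * x) - Real.sigmoid (2 * y)) by ring, abs_mul]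
  rw [show 2 * x - 2 * y = 2 * (x - y) by ring, abs_mul] at h
  norm_num at h ⊢
  linarith

lemma continuous_real_tanh : Continuous Real.tanh := by
  have h : Real.tanh = fun x => 2 * Real.sigmoid (2 * x) - 1 := funext tanh_eq_sigmoid
  rw [h]
  have := continuous_sigmoid
  fun_prop

lemma one_le_geomRatio {a : ℝ} (ha : 0 ≤ a) {t : ℕ} (ht : 1 ≤ t) : 1 ≤ geomRatio a t := by
  unfold geomRatio
  split_ifs with h
  · exact_mod_cast ht
  · rw [← geom_sum_eq h]
    calc (1 : ℝ) = ∑ i ∈ Finset.range 1, a ^ i := by simp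
      _ ≤ _ := Finset.sum_le_sum_of_subset_of_nonneg (Finset.range_mono ht)
          fun i _ _ => pow_nonneg ha i

lemma geomRatio_eq_sum (a : ℝ) (t : ℕ) : geomRatio a t = ∑ i ∈ Finset.range t, a ^ i := by
  unfold geomRatio
  split_ifs with h
  · simp [h]
  · rw [← geom_sum_eq h]

/-! ### Bounds for the LSTM recursion -/

section Recursion

variable {dx dh dy : ℕ}

lemma abs_lstmLayer_apply_le_one {a : ℝ → ℝ} (ha : ∀ x, |a x| ≤ 1)
    (W : Matrix (Fin dh) (Fin dx) ℝ) (U : Matrix (Fin dh) (Fin dh) ℝ)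
    (x : EuclideanSpace ℝ (Fin dx)) (h : EuclideanSpace ℝ (Fin dh)) (i : Fin dh) :
    |lstmLayer a W U x h i| ≤ 1 :=
  ha _

lemma norm_lstmLayer_sub_le {a : ℝ → ℝ} (ha : ∀ x y, |a x - a y| ≤ 1 * |x - y|)
    (W W' : Matrix (Fin dh) (Fin dx) ℝ) (U U' : Matrix (Fin dh) (Fin dh) ℝ)
    (x : EuclideanSpace ℝ (Fin dx)) (h h' : EuclideanSpace ℝ (Fin dh)) :
    ‖lstmLayer a W U x h - lstmLayer a W' U' x h'‖ ≤
      ‖W - W'‖ * ‖x‖ + ‖U‖ * ‖h - h'‖ + ‖U - U'‖ * ‖h'‖ := by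
  have h1 := norm_entrywise_sub_le zero_le_one ha
    (Matrix.toEuclideanLin W x + Matrix.toEuclideanLin U h)
    (Matrix.toEuclideanLin W' x + Matrix.toEuclideanLin U' h')
  rw [one_mul] at h1
  refine h1.trans ?_
  have h2 : Matrix.toEuclideanLin W x + Matrix.toEuclideanLin U h -
      (Matrix.toEuclideanLin W' x + Matrix.toEuclideanLin U' h') =
      Matrix.toEuclideanLin (W - W') x + Matrix.toEuclideanLin U (h - h') +
        Matrix.toEuclideanLin (U - U') h' := by
    simp only [map_sub, LinearMap.sub_apply]
    abel
  rw [h2]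
  exact (norm_add₃_le).trans (add_le_add (add_le_add (norm_toEuclideanLin_le _ _)
    (norm_toEuclideanLin_le _ _)) (norm_toEuclideanLin_le _ _))

lemma lstmLayer_tanh_norm_le (W : Matrix (Fin dh) (Fin dx) ℝ) (U : Matrix (Fin dh) (Fin dh) ℝ)
    (x : EuclideanSpace ℝ (Fin dx)) (h : EuclideanSpace ℝ (Fin dh)) :
    ‖lstmLayer Real.tanh W U x h‖ ≤ ‖W‖ * ‖x‖ + ‖U‖ * ‖h‖ := by
  have h1 := norm_entrywise_le zero_le_one abs_tanh_sub_le Real.tanh_zero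
    (Matrix.toEuclideanLin W x + Matrix.toEuclideanLin U h)
  rw [one_mul] at h1
  exact h1.trans ((norm_add_le _ _).trans
    (add_le_add (norm_toEuclideanLin_le _ _) (norm_toEuclideanLin_le _ _)))

lemma continuous_lstmLayer {α : Type*} [TopologicalSpace α] {a : ℝ → ℝ} (ha : Continuous a)
    (W : Matrix (Fin dh) (Fin dx) ℝ) (U : Matrix (Fin dh) (Fin dh) ℝ)
    {x : α → EuclideanSpace ℝ (Fin dx)} {h : α → EuclideanSpace ℝ (Fin dh)}
    (hx : Continuous x) (hh : Continuous h) :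
    Continuous fun p => lstmLayer a W U (x p) (h p) := by
  have h1 : Continuous (Matrix.toEuclideanLin W) := LinearMap.continuous_of_finiteDimensional _
  have h2 : Continuous (Matrix.toEuclideanLin U) := LinearMap.continuous_of_finiteDimensional _
  exact (continuous_entrywise ha).comp ((h1.comp hx).add (h2.comp hh))

lemma continuous_lstmState (w : LSTMWeights dx dh dy) (n : ℕ) : Continuous (lstmState w n) := by
  induction n with
  | zero => exact continuous_const
  | succ n ih =>
    have hs : Continuous fun X : Fin (n + 1) → EuclideanSpace ℝ (Fin dx) =>
        lstmState w n fun i => X i.castSucc := ih.comp (by fun_prop)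
    have hx : Continuous fun X : Fin (n + 1) → EuclideanSpace ℝ (Fin dx) => X (Fin.last n) := by
      fun_prop
    have hc := (continuous_hadamard
      (continuous_lstmLayer continuous_sigmoid w.Wg w.Ug hx hs.snd) hs.fst).add
      (continuous_hadamard (continuous_lstmLayer continuous_sigmoid w.Wr w.Ur hx hs.snd)
        (continuous_lstmLayer continuous_real_tanh w.Wc w.Uc hx hs.snd))
    exact hc.prodMk (continuous_hadamard
      (continuous_lstmLayer continuous_sigmoid w.Wo w.Uo hx hs.snd)
      ((continuous_entrywise continuous_real_tanh).comp hc))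

lemma continuous_lstmOutput {σy : ℝ → ℝ} (hσ : Continuous σy) (w : LSTMWeights dx dh dy) (n : ℕ) :
    Continuous (lstmOutput σy w n) := by
  have h1 : Continuous (Matrix.toEuclideanLin w.V) := LinearMap.continuous_of_finiteDimensional _
  exact (continuous_entrywise hσ).comp (h1.comp (continuous_lstmState w n).snd)

lemma abs_hidden_apply_le_one (w : LSTMWeights dx dh dy) (n : ℕ)
    (X : Fin n → EuclideanSpace ℝ (Fin dx)) (i : Fin dh) : |(lstmState w n X).2 i| ≤ 1 := by
  cases n with
  | zero => simp [lstmState]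
  | succ n =>
    simp only [lstmState, lstmStep, hadamard, abs_mul]
    exact mul_le_one₀ (abs_lstmLayer_apply_le_one abs_sigmoid_le_one _ _ _ _ i) (abs_nonneg _)
      (abs_tanh_le_one _)

lemma norm_hidden_le_sqrt (w : LSTMWeights dx dh dy) (n : ℕ)
    (X : Fin n → EuclideanSpace ℝ (Fin dx)) : ‖(lstmState w n X).2‖ ≤ √(dh : ℝ) :=
  euclidean_norm_le_sqrt (abs_hidden_apply_le_one w n X)

/-- Gates and `tanh` are bounded by `1`, so each step adds at most `1`. Unlike the bound through
`β`, this one holds for all weights and is used in the perturbation estimate. -/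
lemma abs_cell_apply_le (w : LSTMWeights dx dh dy) (n : ℕ)
    (X : Fin n → EuclideanSpace ℝ (Fin dx)) (i : Fin dh) : |(lstmState w n X).1 i| ≤ n := by
  induction n with
  | zero => simp [lstmState]
  | succ n ih =>
    simp only [lstmState, lstmStep, hadamard, PiLp.add_apply]
    refine (abs_add_le _ _).trans ?_
    rw [abs_mul, abs_mul]
    push_cast
    refine add_le_add ?_ ?_
    · exact (mul_le_of_le_one_left (abs_nonneg _)
        (abs_lstmLayer_apply_le_one abs_sigmoid_le_one _ _ _ _ i)).trans (ih _)
    · exact mul_le_one₀ (abs_lstmLayer_apply_le_one abs_sigmoid_le_one _ _ _ _ i) (abs_nonneg _)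
        (abs_lstmLayer_apply_le_one abs_tanh_le_one _ _ _ _ i)

/-- All weight matrices of `w` and `w'` differ by at most `τ` in spectral norm. -/
def WeightsClose (τ : ℝ) (w w' : LSTMWeights dx dh dy) : Prop :=
  ‖w.Wg - w'.Wg‖ ≤ τ ∧ ‖w.Wr - w'.Wr‖ ≤ τ ∧ ‖w.Wo - w'.Wo‖ ≤ τ ∧ ‖w.Wc - w'.Wc‖ ≤ τ ∧
    ‖w.Ug - w'.Ug‖ ≤ τ ∧ ‖w.Ur - w'.Ur‖ ≤ τ ∧ ‖w.Uo - w'.Uo‖ ≤ τ ∧ ‖w.Uc - w'.Uc‖ ≤ τ ∧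
    ‖w.V - w'.V‖ ≤ τ

end Recursion

/-- The state is Lipschitz in the weights, with a constant that does not depend on the dimensions
beyond the factor `1 + √dh`. -/
lemma exists_lipschitz_lstmState (Q Bx : ℝ) (hQ : 0 ≤ Q) (hBx : 0 ≤ Bx) (n : ℕ) :
    ∃ L : ℝ, 0 ≤ L ∧ ∀ (dx dh dy : ℕ) (w w' : LSTMWeights dx dh dy) (τ : ℝ), 0 ≤ τ →
      ‖w.Ug‖ ≤ Q → ‖w.Ur‖ ≤ Q → ‖w.Uo‖ ≤ Q → ‖w.Uc‖ ≤ Q → WeightsClose τ w w' →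
      ∀ X : Fin n → EuclideanSpace ℝ (Fin dx), (∀ i, ‖X i‖ ≤ Bx) →
        ‖(lstmState w n X).1 - (lstmState w' n X).1‖ +
          ‖(lstmState w n X).2 - (lstmState w' n X).2‖ ≤ L * (τ * (1 + √(dh : ℝ))) := by
  induction n with
  | zero => exact ⟨0, le_rfl, by simp [lstmState]⟩
  | succ n ih =>
    obtain ⟨L, hL, ih⟩ := ih
    -- With `E = ((1 + Bx) + Q L) D` bounding the error of each layer, the cell error is at most `L
    -- D + (n + 2) E` (`n` from the size of the old cell state) and the hidden error at most `L D +
    -- (n + 3) E`.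
    refine ⟨2 * L + (2 * n + 5) * ((1 + Bx) + Q * L), by positivity, ?_⟩
    intro dx dh dy w w' τ hτ hg hr ho hc hclose X hX
    have ih' := ih dx dh dy w w' τ hτ hg hr ho hc hclose (fun i => X i.castSucc)
      (fun i => hX _)
    obtain ⟨cWg, cWr, cWo, cWc, cUg, cUr, cUo, cUc, -⟩ := hclose
    have hx := hX (Fin.last n)
    have hh' := norm_hidden_le_sqrt w' n fun i => X i.castSucc
    have hcell := abs_cell_apply_le w' n fun i => X i.castSucc
    simp only [lstmState, lstmStep]
    generalize X (Fin.last n) = x at *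
    generalize lstmState w n (fun i => X i.castSucc) = s at *
    generalize lstmState w' n (fun i => X i.castSucc) = s' at *
    set D := τ * (1 + √(dh : ℝ)) with hD
    have hD0 : 0 ≤ D := by positivity
    have hs0 : 0 ≤ √(dh : ℝ) := Real.sqrt_nonneg _
    have hlayer : ∀ {a : ℝ → ℝ} (_ : ∀ x y, |a x - a y| ≤ 1 * |x - y|)
        {W W' : Matrix (Fin dh) (Fin dx) ℝ} {U U' : Matrix (Fin dh) (Fin dh) ℝ},
        ‖W - W'‖ ≤ τ → ‖U - U'‖ ≤ τ → ‖U‖ ≤ Q →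
        ‖lstmLayer a W U x s.2 - lstmLayer a W' U' x s'.2‖ ≤ ((1 + Bx) + Q * L) * D := by
      intro a ha W W' U U' hW hU hUQ
      refine (norm_lstmLayer_sub_le ha W W' U U' x s.2 s'.2).trans ?_
      have h1 : ‖W - W'‖ * ‖x‖ ≤ τ * Bx := mul_le_mul hW hx (norm_nonneg _) hτ
      have h2 : ‖U‖ * ‖s.2 - s'.2‖ ≤ Q * (L * D) :=
        mul_le_mul hUQ (by linarith [norm_nonneg (s.1 - s'.1)]) (norm_nonneg _) hQ
      have h3 : ‖U - U'‖ * ‖s'.2‖ ≤ τ * √(dh : ℝ) := mul_le_mul hU hh' (norm_nonneg _) hτ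
      have h4 : τ * Bx + τ * √(dh : ℝ) ≤ (1 + Bx) * D := by
        rw [hD]
        have := mul_nonneg hτ (mul_nonneg hBx hs0)
        nlinarith
      linarith
    have eg := hlayer abs_sigmoid_sub_le_one_mul cWg cUg hg
    have er := hlayer abs_sigmoid_sub_le_one_mul cWr cUr hr
    have eo := hlayer abs_sigmoid_sub_le_one_mul cWo cUo ho
    have ec := hlayer abs_tanh_sub_le cWc cUc hc
    have bg := abs_lstmLayer_apply_le_one abs_sigmoid_le_one w.Wg w.Ug x s.2
    have br := abs_lstmLayer_apply_le_one abs_sigmoid_le_one w.Wr w.Ur x s.2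
    have bo := abs_lstmLayer_apply_le_one abs_sigmoid_le_one w.Wo w.Uo x s.2
    have bc := abs_lstmLayer_apply_le_one abs_tanh_le_one w'.Wc w'.Uc x s'.2
    have h1 := norm_hadamard_sub_hadamard_le zero_le_one (Nat.cast_nonneg n)
      (u' := lstmLayer Real.sigmoid w'.Wg w'.Ug x s'.2) (v := s.1) bg hcell
    have h2 := norm_hadamard_sub_hadamard_le zero_le_one zero_le_one
      (u' := lstmLayer Real.sigmoid w'.Wr w'.Ur x s'.2)
      (v := lstmLayer Real.tanh w.Wc w.Uc x s.2) br bc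
    generalize lstmLayer Real.sigmoid w.Wg w.Ug x s.2 = g at *
    generalize lstmLayer Real.sigmoid w.Wr w.Ur x s.2 = r at *
    generalize lstmLayer Real.sigmoid w.Wo w.Uo x s.2 = o at *
    generalize lstmLayer Real.tanh w.Wc w.Uc x s.2 = k at *
    generalize lstmLayer Real.sigmoid w'.Wg w'.Ug x s'.2 = g' at *
    generalize lstmLayer Real.sigmoid w'.Wr w'.Ur x s'.2 = r' at *
    generalize lstmLayer Real.sigmoid w'.Wo w'.Uo x s'.2 = o' at *
    generalize lstmLayer Real.tanh w'.Wc w'.Uc x s'.2 = k' at *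
    have hcd : ‖(hadamard g s.1 + hadamard r k) - (hadamard g' s'.1 + hadamard r' k')‖ ≤
        L * D + (n + 2) * (((1 + Bx) + Q * L) * D) := by
      rw [add_sub_add_comm]
      refine (norm_add_le _ _).trans ?_
      have h3 : (n : ℝ) * ‖g - g'‖ ≤ n * (((1 + Bx) + Q * L) * D) :=
        mul_le_mul_of_nonneg_left eg (Nat.cast_nonneg n)
      linarith [norm_nonneg (s.2 - s'.2)]
    generalize hadamard g s.1 + hadamard r k = c at *
    generalize hadamard g' s'.1 + hadamard r' k' = c' at *
    have h4 := norm_hadamard_sub_hadamard_le zero_le_one zero_le_one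
      (u' := o') (v := entrywise Real.tanh c) (v' := entrywise Real.tanh c') bo
      (fun i => abs_tanh_le_one _)
    have h5 := norm_entrywise_sub_le zero_le_one abs_tanh_sub_le c c'
    linarith

section Recursion

variable {dx dh dy : ℕ}

/-- From the zero state a zero input gives `c = g ⊙ 0 + r ⊙ tanh 0 = 0`, hence `h = 0`: the network
can idle for one step. -/
lemma lstmState_cons_zero (w : LSTMWeights dx dh dy) (n : ℕ)
    (X : Fin n → EuclideanSpace ℝ (Fin dx)) :
    lstmState w (n + 1) (Fin.cons 0 X : Fin (n + 1) → EuclideanSpace ℝ (Fin dx)) =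
      lstmState w n X := by
  induction n with
  | zero =>
    have h0 : ∀ u : EuclideanSpace ℝ (Fin dh), hadamard u 0 = 0 := by
      intro u
      ext i
      simp [hadamard]
    have h1 : entrywise Real.tanh (0 : EuclideanSpace ℝ (Fin dh)) = 0 := by
      ext i
      simp [entrywise]
    have h2 : Fin.last 0 = 0 := rfl
    simp [lstmState, lstmStep, lstmLayer, h0, h1, h2]
  | succ n ih =>
    have h1 : (fun i : Fin (n + 1) =>
        (Fin.cons 0 X : Fin (n + 1 + 1) → EuclideanSpace ℝ (Fin dx)) i.castSucc) =
        Fin.cons 0 fun i : Fin n => X i.castSucc := by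
      funext i
      refine Fin.cases ?_ (fun j => ?_) i
      · simp
      · rw [← Fin.succ_castSucc, Fin.cons_succ, Fin.cons_succ]
    have h2 : (Fin.cons 0 X : Fin (n + 1 + 1) → EuclideanSpace ℝ (Fin dx)) (Fin.last (n + 1)) =
        X (Fin.last n) := by
      rw [← Fin.succ_last, Fin.cons_succ]
    rw [lstmState, h1, h2, ih, ← lstmState]

lemma gateO_cons_zero (w : LSTMWeights dx dh dy) (n : ℕ)
    (X : Fin (n + 1) → EuclideanSpace ℝ (Fin dx)) :
    gateO w (n + 1) (Fin.cons 0 X) = gateO w n X := by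
  have h1 : (fun i : Fin (n + 1) =>
      (Fin.cons 0 X : Fin (n + 1 + 1) → EuclideanSpace ℝ (Fin dx)) i.castSucc) =
      Fin.cons 0 fun i : Fin n => X i.castSucc := by
    funext i
    refine Fin.cases ?_ (fun j => ?_) i
    · simp
    · rw [← Fin.succ_castSucc, Fin.cons_succ, Fin.cons_succ]
  have h2 : (Fin.cons 0 X : Fin (n + 1 + 1) → EuclideanSpace ℝ (Fin dx)) (Fin.last (n + 1)) =
      X (Fin.last n) := by
    rw [← Fin.succ_last, Fin.cons_succ]
  rw [gateO, h1, h2, lstmState_cons_zero, ← gateO]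

lemma vecInfNorm_nonneg {n : ℕ} (v : EuclideanSpace ℝ (Fin n)) : 0 ≤ vecInfNorm v :=
  Real.iSup_nonneg fun _ => abs_nonneg _

lemma abs_apply_le_vecInfNorm {n : ℕ} (v : EuclideanSpace ℝ (Fin n)) (i : Fin n) :
    |v i| ≤ vecInfNorm v :=
  le_ciSup (f := fun i => |v i|) (Set.finite_range _).bddAbove i

lemma vecInfNorm_le_one {n : ℕ} {v : EuclideanSpace ℝ (Fin n)} (h : ∀ i, |v i| ≤ 1) :
    vecInfNorm v ≤ 1 :=
  Real.iSup_le h zero_le_one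

lemma funInfNorm_nonneg {n : ℕ} (Bx : ℝ)
    (G : (Fin n → EuclideanSpace ℝ (Fin dx)) → EuclideanSpace ℝ (Fin dh)) :
    0 ≤ funInfNorm Bx G := by
  apply Real.sSup_nonneg
  rintro a ⟨X, -, rfl⟩
  exact vecInfNorm_nonneg _

/-- The bound by `1` makes the set under `sSup` bounded above, so that the supremum is a genuine
one. -/
lemma vecInfNorm_le_funInfNorm {n : ℕ} {Bx : ℝ}
    {G : (Fin n → EuclideanSpace ℝ (Fin dx)) → EuclideanSpace ℝ (Fin dh)}
    (hG : ∀ X i, |G X i| ≤ 1) {X : Fin n → EuclideanSpace ℝ (Fin dx)} (hX : ∀ i, ‖X i‖ ≤ Bx) :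
    vecInfNorm (G X) ≤ funInfNorm Bx G := by
  refine le_csSup ⟨1, ?_⟩ ⟨X, hX, rfl⟩
  rintro a ⟨Y, -, rfl⟩
  exact vecInfNorm_le_one (hG Y)

lemma abs_gateG_apply_le_one (w : LSTMWeights dx dh dy) (n : ℕ)
    (X : Fin (n + 1) → EuclideanSpace ℝ (Fin dx)) (i : Fin dh) : |gateG w n X i| ≤ 1 :=
  abs_sigmoid_le_one _

lemma abs_gateR_apply_le_one (w : LSTMWeights dx dh dy) (n : ℕ)
    (X : Fin (n + 1) → EuclideanSpace ℝ (Fin dx)) (i : Fin dh) : |gateR w n X i| ≤ 1 :=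
  abs_sigmoid_le_one _

lemma abs_gateO_apply_le_one (w : LSTMWeights dx dh dy) (n : ℕ)
    (X : Fin (n + 1) → EuclideanSpace ℝ (Fin dx)) (i : Fin dh) : |gateO w n X i| ≤ 1 :=
  abs_sigmoid_le_one _

/-- A zero input does not move the zero state, so later output gates take at least the values of
the earlier ones. -/
lemma funInfNorm_gateO_le_succ {Bx : ℝ} (hBx : 0 ≤ Bx) (w : LSTMWeights dx dh dy) (n : ℕ) :
    funInfNorm Bx (gateO w n) ≤ funInfNorm Bx (gateO w (n + 1)) := by
  apply Real.sSup_le _ (funInfNorm_nonneg _ _)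
  rintro a ⟨X, hX, rfl⟩
  rw [← gateO_cons_zero]
  apply vecInfNorm_le_funInfNorm (abs_gateO_apply_le_one w (n + 1))
  intro i
  refine Fin.cases ?_ (fun j => ?_) i
  · simpa using hBx
  · simpa using hX j

lemma lstmBeta_nonneg {B : LSTMNormBounds} (hUc : 0 ≤ B.Uc) (Bx : ℝ) (t : ℕ)
    (w : LSTMWeights dx dh dy) : 0 ≤ lstmBeta B Bx t w := by
  apply Real.iSup_nonneg
  intro n
  have h1 := funInfNorm_nonneg Bx (gateG w n)
  have h2 := funInfNorm_nonneg Bx (gateR w n)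
  have h3 := funInfNorm_nonneg Bx (gateO w n)
  positivity

/-- The recursion for `c_{n+1}` pairs `r_{n+1}` with the earlier gate `o_n`, whereas `β` pairs gates
of equal time. Since `gateO w n` is `o_{n+1}`, the shift is made here through the monotonicity of
`‖o_j‖_∞` in `j`. -/
lemma norm_hidden_le_gateO_mul {Bx : ℝ} (hBx : 0 ≤ Bx) (w : LSTMWeights dx dh dy) (n : ℕ)
    {X : Fin n → EuclideanSpace ℝ (Fin dx)} (hX : ∀ i, ‖X i‖ ≤ Bx) :
    ‖(lstmState w n X).2‖ ≤ funInfNorm Bx (gateO w n) * ‖(lstmState w n X).1‖ := by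
  cases n with
  | zero => simp [lstmState]
  | succ n =>
    have h1 : ‖(lstmState w (n + 1) X).2‖ ≤
        funInfNorm Bx (gateO w n) * ‖entrywise Real.tanh (lstmState w (n + 1) X).1‖ :=
      norm_hadamard_le (funInfNorm_nonneg _ _) (fun i => (abs_apply_le_vecInfNorm _ i).trans
        (vecInfNorm_le_funInfNorm (abs_gateO_apply_le_one w n) hX)) _
    have h2 := norm_entrywise_le zero_le_one abs_tanh_sub_le Real.tanh_zero
      (lstmState w (n + 1) X).1
    rw [one_mul] at h2
    exact h1.trans (mul_le_mul (funInfNorm_gateO_le_succ hBx w n) h2 (norm_nonneg _)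
      (funInfNorm_nonneg _ _))

/-- Unrolling `‖c_{n+1}‖ ≤ (G + B.Uc R O) ‖c_n‖ + R B.Wc Bx`, where the bracket is at most `β` and
`R ≤ 1`, gives a geometric sum. -/
lemma norm_cell_le {B : LSTMNormBounds} {Bx : ℝ} (hBx : 0 ≤ Bx) {w : LSTMWeights dx dh dy}
    (hWc : ‖w.Wc‖ ≤ B.Wc) (hUc : ‖w.Uc‖ ≤ B.Uc) (t n : ℕ) (hn : n ≤ t)
    {X : Fin n → EuclideanSpace ℝ (Fin dx)} (hX : ∀ i, ‖X i‖ ≤ Bx) :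
    ‖(lstmState w n X).1‖ ≤
      B.Wc * Bx * ∑ i ∈ Finset.range n, lstmBeta B Bx t w ^ i := by
  have hWc0 : 0 ≤ B.Wc := (norm_nonneg _).trans hWc
  have hUc0 : 0 ≤ B.Uc := (norm_nonneg _).trans hUc
  induction n with
  | zero => simp [lstmState]
  | succ n ih =>
    have ih' := ih (by omega) (X := fun i => X i.castSucc) fun i => hX _
    have hh := norm_hidden_le_gateO_mul hBx w n (X := fun i => X i.castSucc) fun i => hX _
    set G := funInfNorm Bx (gateG w n) with hG
    set R := funInfNorm Bx (gateR w n) with hR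
    set O := funInfNorm Bx (gateO w n) with hO
    have hG0 : 0 ≤ G := funInfNorm_nonneg _ _
    have hR0 : 0 ≤ R := funInfNorm_nonneg _ _
    have hO0 : 0 ≤ O := funInfNorm_nonneg _ _
    have hR1 : R ≤ 1 := by
      apply Real.sSup_le _ zero_le_one
      rintro a ⟨Y, -, rfl⟩
      exact vecInfNorm_le_one (abs_gateR_apply_le_one w n Y)
    have hβ : G + B.Uc * R * O ≤ lstmBeta B Bx t w :=
      le_ciSup (f := fun n : Fin t => funInfNorm Bx (gateG w n) +
        B.Uc * funInfNorm Bx (gateR w n) * funInfNorm Bx (gateO w n))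
        (Set.finite_range _).bddAbove ⟨n, by omega⟩
    set c := (lstmState w n fun i => X i.castSucc).1 with hc
    set h := (lstmState w n fun i => X i.castSucc).2 with hhdef
    have e : (lstmState w (n + 1) X).1 = hadamard (gateG w n X) c +
        hadamard (gateR w n X) (lstmLayer Real.tanh w.Wc w.Uc (X (Fin.last n)) h) := rfl
    have h1 : ‖hadamard (gateG w n X) c‖ ≤ G * ‖c‖ :=
      norm_hadamard_le hG0 (fun i => (abs_apply_le_vecInfNorm _ i).trans
        (vecInfNorm_le_funInfNorm (abs_gateG_apply_le_one w n) hX)) _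
    have h2 : ‖hadamard (gateR w n X) (lstmLayer Real.tanh w.Wc w.Uc (X (Fin.last n)) h)‖ ≤
        R * (B.Wc * Bx + B.Uc * (O * ‖c‖)) := by
      refine (norm_hadamard_le hR0 (fun i => (abs_apply_le_vecInfNorm _ i).trans
        (vecInfNorm_le_funInfNorm (abs_gateR_apply_le_one w n) hX)) _).trans ?_
      refine mul_le_mul_of_nonneg_left ((lstmLayer_tanh_norm_le _ _ _ _).trans ?_) hR0
      exact add_le_add (mul_le_mul hWc (hX _) (norm_nonneg _) hWc0)
        (mul_le_mul hUc hh (norm_nonneg _) hUc0)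
    have hM : 0 ≤ B.Wc * Bx := mul_nonneg hWc0 hBx
    have hβ0 := lstmBeta_nonneg hUc0 Bx t w
    rw [e, Finset.sum_range_succ']
    simp only [pow_succ, ← Finset.sum_mul, pow_zero]
    refine (norm_add_le _ _).trans ?_
    have h3 : (G + B.Uc * R * O) * ‖c‖ ≤ lstmBeta B Bx t w *
        (B.Wc * Bx * ∑ i ∈ Finset.range n, lstmBeta B Bx t w ^ i) :=
      mul_le_mul hβ ih' (norm_nonneg _) hβ0
    have h4 : R * (B.Wc * Bx) ≤ 1 * (B.Wc * Bx) := mul_le_mul_of_nonneg_right hR1 hM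
    nlinarith

lemma norm_hidden_le {B : LSTMNormBounds} {Bx : ℝ} (hBx : 0 ≤ Bx) {w : LSTMWeights dx dh dy}
    (hWc : ‖w.Wc‖ ≤ B.Wc) (hUc : ‖w.Uc‖ ≤ B.Uc) (t : ℕ)
    {X : Fin t → EuclideanSpace ℝ (Fin dx)} (hX : ∀ i, ‖X i‖ ≤ Bx) :
    ‖(lstmState w t X).2‖ ≤ B.Wc * Bx * geomRatio (lstmBeta B Bx t w) t := by
  have h1 := norm_hidden_le_gateO_mul hBx w t hX
  have h2 := norm_cell_le hBx hWc hUc t t le_rfl hX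
  have h3 : funInfNorm Bx (gateO w t) ≤ 1 := by
    apply Real.sSup_le _ zero_le_one
    rintro a ⟨Y, -, rfl⟩
    exact vecInfNorm_le_one (abs_gateO_apply_le_one w t Y)
  rw [geomRatio_eq_sum]
  exact h1.trans ((mul_le_of_le_one_left (norm_nonneg _) h3).trans h2)

end Recursion

/-! ### Margins and the ramp loss -/

lemma margin_zero {K : ℕ} (z : Fin K) : margin (0 : EuclideanSpace ℝ (Fin K)) z = 0 := by
  simp [margin]

/-- A coordinate and a maximum of coordinates are each 1-Lipschitz, which accounts for the factor
`2`. -/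
lemma abs_margin_sub_le {K : ℕ} (y y' : EuclideanSpace ℝ (Fin K)) (z : Fin K) :
    |margin y z - margin y' z| ≤ 2 * ‖y - y'‖ := by
  have hle : ∀ u v : EuclideanSpace ℝ (Fin K), (⨆ j : {j : Fin K // j ≠ z}, u j) ≤
      (⨆ j : {j : Fin K // j ≠ z}, v j) + ‖u - v‖ := by
    intro u v
    rcases isEmpty_or_nonempty {j : Fin K // j ≠ z} with h | h
    -- For `K = 1` both suprema are over the empty type and equal `0`.
    · simp
    · refine ciSup_le fun j => ?_
      have h1 := le_ciSup (f := fun j : {j : Fin K // j ≠ z} => v j)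
        (Set.finite_range _).bddAbove j
      have h2 := (abs_le.mp (abs_apply_le_norm (u - v) j)).2
      simp only [PiLp.sub_apply] at h2
      linarith
  have h1 := hle y y'
  have h2 := hle y' y
  rw [norm_sub_rev] at h2
  have h3 := abs_le.mp (abs_apply_le_norm (y - y') z)
  simp only [PiLp.sub_apply] at h3
  unfold margin
  rw [abs_le]
  constructor <;> linarith

/-- This identity moves the argument from losses to clipped margins, whose range is also limited by
the size of the margin and not only by `γ`. -/
lemma rampLoss_neg {γ : ℝ} (hγ : 0 < γ) (a : ℝ) :
    rampLoss γ (-a) = 1 - min γ (max a 0) / γ := by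
  unfold rampLoss
  rcases lt_trichotomy a 0 with h | h | h
  · have h1 : 0 < -a := by linarith
    have h2 : ¬ (-γ ≤ -a ∧ -a ≤ 0) := fun h => by linarith [h.2]
    rw [if_pos h1, if_neg h2, max_eq_right h.le, min_eq_right hγ.le]
    simp
  · subst h
    simp [hγ.le]
  · have h1 : ¬ 0 < -a := by linarith
    rw [if_neg h1, max_eq_left h.le]
    by_cases h2 : a ≤ γ
    · rw [if_pos ⟨by linarith, by linarith⟩, min_eq_right h2]
      ring
    · rw [if_neg (fun h => h2 (by linarith [h.1])), min_eq_left (le_of_not_ge h2), div_self hγ.ne']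
      simp

lemma margin_nonpos_of_misclassified {K : ℕ} {φ : EuclideanSpace ℝ (Fin K) → Fin K}
    (hφ : ∀ (y : EuclideanSpace ℝ (Fin K)) (j : Fin K), y j ≤ y (φ y))
    {y : EuclideanSpace ℝ (Fin K)} {z : Fin K} (h : φ y ≠ z) : margin y z ≤ 0 := by
  have h1 := le_ciSup (f := fun j : {j : Fin K // j ≠ z} => y j)
    (Set.finite_range _).bddAbove ⟨φ y, h⟩
  have h2 := hφ y z
  simp only at h1
  unfold margin
  linarith

lemma continuous_margin {K : ℕ} (z : Fin K) :
    Continuous fun y : EuclideanSpace ℝ (Fin K) => margin y z := by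
  refine LipschitzWith.continuous (K := 2) (LipschitzWith.of_dist_le_mul fun y y' => ?_)
  rw [Real.dist_eq, dist_eq_norm]
  exact abs_margin_sub_le y y' z

/-! ### Uniform deviations over a finitely covered class -/

section Deviation

variable {Ω : Type*} [MeasurableSpace Ω]

/-- One-sided Hoeffding inequality for the empirical mean of an i.i.d. sample. -/
lemma hoeffding_empirical_mean (D : Measure Ω) [IsProbabilityMeasure D] {g : Ω → ℝ}
    (hg : Measurable g) {b : ℝ} (hb : 0 < b) (hgb : ∀ᵐ p ∂D, g p ∈ Set.Icc 0 b) {m : ℕ}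
    (hm : 0 < m) {s : ℝ} (hs : 0 ≤ s) :
    (Measure.pi fun _ : Fin m => D).real
      {S | b * s ≤ (1 / (m : ℝ)) * ∑ i, g (S i) - ∫ p, g p ∂D} ≤ Real.exp (-(2 * m * s ^ 2)) := by
  set μ := Measure.pi fun _ : Fin m => D with hμ
  have hind : ProbabilityTheory.iIndepFun (fun (i : Fin m) (S : Fin m → Ω) =>
      g (S i) - ∫ p, g p ∂D) μ :=
    ProbabilityTheory.iIndepFun_pi (X := fun _ p => g p - ∫ p, g p ∂D)
      fun _ => (hg.sub_const _).aemeasurable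
  have hmp : ∀ i : Fin m, MeasurePreserving (Function.eval i) μ D := fun i =>
    measurePreserving_eval (fun _ : Fin m => D) i
  have hsub : ∀ i ∈ (Finset.univ : Finset (Fin m)), ProbabilityTheory.HasSubgaussianMGF
      (fun S : Fin m → Ω => g (S i) - ∫ p, g p ∂D) ((‖b - 0‖₊ / 2) ^ 2) μ := by
    intro i _
    have h1 := ProbabilityTheory.hasSubgaussianMGF_of_mem_Icc (μ := μ)
      (X := fun S : Fin m → Ω => g (S i)) (a := 0) (b := b)
      (hg.comp (measurable_pi_apply i)).aemeasurable
      ((hmp i).quasiMeasurePreserving.ae hgb)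
    have h2 : ∫ S, g (S i) ∂μ = ∫ p, g p ∂D := by
      have h3 := integral_map (hmp i).aemeasurable (f := g) hg.aestronglyMeasurable
      rw [(hmp i).map_eq] at h3
      exact h3.symm
    rwa [h2] at h1
  have hm' : (0 : ℝ) < m := by exact_mod_cast hm
  have h := ProbabilityTheory.HasSubgaussianMGF.measure_sum_ge_le_of_iIndepFun hind hsub
    (ε := m * (b * s)) (by positivity)
  have hset : {S : Fin m → Ω | b * s ≤ (1 / (m : ℝ)) * ∑ i, g (S i) - ∫ p, g p ∂D} =
      {S | m * (b * s) ≤ ∑ i, (g (S i) - ∫ p, g p ∂D)} := by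
    ext S
    have e : (1 / (m : ℝ)) * ∑ i, g (S i) - ∫ p, g p ∂D =
        (∑ i, (g (S i) - ∫ p, g p ∂D)) / m := by
      rw [Finset.sum_sub_distrib]
      simp
      field_simp
    rw [Set.mem_ofPred_eq, Set.mem_ofPred_eq, e, le_div_iff₀ hm', mul_comm]
  rw [hset]
  refine h.trans (le_of_eq ?_)
  -- The sub-Gaussian parameter `(b / 2) ^ 2` gives the exponent `(m b s) ^ 2 / (2 m (b / 2) ^ 2) =
  -- 2 m s ^ 2`.
  congr 1
  simp only [Finset.sum_const, Finset.card_univ, Fintype.card_fin, nsmul_eq_mul, sub_zero]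
  push_cast
  rw [Real.norm_eq_abs, abs_of_pos hb]
  field_simp

/-- Uniform one-sided deviation bound over a class with an internal finite sup-norm cover. The
deviation of each function scales with its own upper bound. -/
theorem uniform_deviation (D : Measure Ω) [IsProbabilityMeasure D] {A : Set Ω}
    (hA : ∀ᵐ p ∂D, p ∈ A) {ι : Type*} {F : ι → Ω → ℝ} (hF : ∀ i, Measurable (F i)) {P : Set ι}
    {b : ι → ℝ} (hF0 : ∀ i ∈ P, ∀ p ∈ A, 0 ≤ F i p) (hFb : ∀ i ∈ P, ∀ p ∈ A, F i p ≤ b i) {ε : ℝ}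
    (hε : 0 < ε) {C : Finset ι} (hCP : ∀ c ∈ C, c ∈ P)
    (hcover : ∀ i ∈ P, ∃ c ∈ C, ∀ p ∈ A, |F i p - F c p| ≤ ε) {N : ℝ} (hN : 1 ≤ N)
    (hCN : (C.card : ℝ) ≤ N) {m : ℕ} (hm : 0 < m) {δ : ℝ} (hδ0 : 0 < δ) (hδ1 : δ < 1) :
    (Measure.pi fun _ : Fin m => D)
      {S | ¬ ((∀ j, S j ∈ A) ∧ ∀ i ∈ P, (1 / (m : ℝ)) * ∑ j, F i (S j) - ∫ p, F i p ∂D ≤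
        2 * ε + (b i + 2 * ε) * √(Real.log (N / δ) / (2 * m)))} ≤ ENNReal.ofReal δ := by
  set μ := Measure.pi fun _ : Fin m => D with hμ
  set s := √(Real.log (N / δ) / (2 * m)) with hs
  have hm' : (0 : ℝ) < m := by exact_mod_cast hm
  have hAne : A.Nonempty := by
    obtain ⟨p, hp⟩ := hA.exists
    exact ⟨p, hp⟩
  -- Hoeffding is applied at cover centres `c`, and `b c` need not be related to `b i`. The true
  -- supremum moves by at most `ε` between `i` and its centre, so `B c ≤ b i + 2 ε`; the added `ε`
  -- keeps `B` positive.
  set B : ι → ℝ := fun i => sSup (F i '' A) + ε with hB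
  have hbdd : ∀ i ∈ P, BddAbove (F i '' A) := by
    rintro i hi
    refine ⟨b i, ?_⟩
    rintro _ ⟨p, hp, rfl⟩
    exact hFb i hi p hp
  have hBF : ∀ i ∈ P, ∀ p ∈ A, F i p ≤ B i := fun i hi p hp =>
    (le_csSup (hbdd i hi) ⟨p, hp, rfl⟩).trans (by simp only [hB]; linarith)
  have hBpos : ∀ i ∈ P, 0 < B i := by
    intro i hi
    have : 0 ≤ sSup (F i '' A) := by
      apply Real.sSup_nonneg
      rintro _ ⟨p, hp, rfl⟩
      exact hF0 i hi p hp
    simp only [hB]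
    linarith
  have hint : ∀ i ∈ P, Integrable (F i) D := fun i hi =>
    Integrable.of_mem_Icc 0 (b i) (hF i).aemeasurable
      (by filter_upwards [hA] with p hp using ⟨hF0 i hi p hp, hFb i hi p hp⟩)
  set bad : ι → Set (Fin m → Ω) := fun c =>
    {S | B c * s ≤ (1 / (m : ℝ)) * ∑ j, F c (S j) - ∫ p, F c p ∂D} with hbad
  have hlog : 0 ≤ Real.log (N / δ) := by
    apply Real.log_nonneg
    rw [le_div_iff₀ hδ0]
    linarith
  have hNδ : 0 < N / δ := by positivity
  have hbadm : ∀ c ∈ C, μ (bad c) ≤ ENNReal.ofReal (δ / N) := by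
    intro c hc
    have h := hoeffding_empirical_mean D (hF c) (hBpos c (hCP c hc))
      (by filter_upwards [hA] with p hp using ⟨hF0 c (hCP c hc) p hp, hBF c (hCP c hc) p hp⟩) hm
      (Real.sqrt_nonneg (Real.log (N / δ) / (2 * m)))
    have e : Real.exp (-(2 * m * √(Real.log (N / δ) / (2 * m)) ^ 2)) = δ / N := by
      rw [Real.sq_sqrt (by positivity), mul_div_cancel₀ _ (by positivity), Real.exp_neg,
        Real.exp_log hNδ, inv_div]
    rw [e] at h
    rw [← ENNReal.ofReal_toReal (measure_ne_top μ (bad c))]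
    exact ENNReal.ofReal_le_ofReal h
  have hnull : μ {S | ¬ ∀ j, S j ∈ A} = 0 := by
    have h : ∀ᵐ S ∂μ, ∀ j, S j ∈ A := by
      rw [ae_all_iff]
      intro j
      exact (Measure.quasiMeasurePreserving_eval (fun _ : Fin m => D) j).ae hA
    exact h
  have hsubset : {S | ¬ ((∀ j, S j ∈ A) ∧ ∀ i ∈ P, (1 / (m : ℝ)) * ∑ j, F i (S j) -
      ∫ p, F i p ∂D ≤ 2 * ε + (b i + 2 * ε) * s)} ⊆
      {S | ¬ ∀ j, S j ∈ A} ∪ ⋃ c ∈ C, bad c := by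
    intro S hS
    by_contra hcon
    rw [Set.mem_union, not_or] at hcon
    obtain ⟨h1, h2⟩ := hcon
    have hSA : ∀ j, S j ∈ A := by simpa using h1
    refine hS ⟨hSA, fun i hi => ?_⟩
    obtain ⟨c, hc, hic⟩ := hcover i hi
    have h3 : (1 / (m : ℝ)) * ∑ j, F c (S j) - ∫ p, F c p ∂D < B c * s := by
      by_contra h4
      exact h2 (Set.mem_biUnion hc (not_lt.mp h4))
    have h5 : (1 / (m : ℝ)) * ∑ j, F i (S j) ≤ (1 / (m : ℝ)) * ∑ j, F c (S j) + ε := by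
      have : ∑ j, F i (S j) ≤ ∑ j, (F c (S j) + ε) := by
        apply Finset.sum_le_sum
        intro j _
        linarith [(abs_le.mp (hic _ (hSA j))).2]
      rw [Finset.sum_add_distrib] at this
      simp only [Finset.sum_const, Finset.card_univ, Fintype.card_fin, nsmul_eq_mul] at this
      calc (1 / (m : ℝ)) * ∑ j, F i (S j) ≤ (1 / (m : ℝ)) * (∑ j, F c (S j) + m * ε) :=
            mul_le_mul_of_nonneg_left this (by positivity)
        _ = _ := by field_simp
    have h6 : ∫ p, F c p ∂D ≤ ∫ p, F i p ∂D + ε := by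
      have : ∫ p, F c p ∂D ≤ ∫ p, (F i p + ε) ∂D := by
        apply integral_mono_ae (hint c (hCP c hc)) ((hint i hi).add (integrable_const ε))
        filter_upwards [hA] with p hp
        have := (abs_le.mp (hic p hp)).1
        show F c p ≤ F i p + ε
        linarith
      rw [integral_add (hint i hi) (integrable_const ε)] at this
      simpa using this
    have h7 : B c ≤ b i + 2 * ε := by
      have : sSup (F c '' A) ≤ b i + ε := by
        apply csSup_le (hAne.image _)
        rintro _ ⟨p, hp, rfl⟩
        linarith [(abs_le.mp (hic p hp)).1, hFb i hi p hp]
      simp only [hB]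
      linarith
    have h8 : B c * s ≤ (b i + 2 * ε) * s := mul_le_mul_of_nonneg_right h7 (Real.sqrt_nonneg _)
    linarith
  calc μ _ ≤ μ ({S | ¬ ∀ j, S j ∈ A} ∪ ⋃ c ∈ C, bad c) := measure_mono hsubset
    _ ≤ μ {S | ¬ ∀ j, S j ∈ A} + μ (⋃ c ∈ C, bad c) := measure_union_le _ _
    _ ≤ 0 + ∑ c ∈ C, μ (bad c) := by
        rw [hnull]
        exact add_le_add le_rfl (measure_biUnion_finset_le _ _)
    _ ≤ ∑ _c ∈ C, ENNReal.ofReal (δ / N) := by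
        rw [zero_add]
        exact Finset.sum_le_sum hbadm
    _ = ENNReal.ofReal (C.card * (δ / N)) := by
        rw [Finset.sum_const, nsmul_eq_mul, ENNReal.ofReal_mul (Nat.cast_nonneg _)]
        simp
    _ ≤ ENNReal.ofReal δ := by
        apply ENNReal.ofReal_le_ofReal
        calc (C.card : ℝ) * (δ / N) ≤ N * (δ / N) :=
              mul_le_mul_of_nonneg_right hCN (by positivity)
          _ = δ := by field_simp

end Deviation

/-- A class with finitely many real parameters in `[-R, R]` has an internal cover, in the sup
distance of the parameters, of at most `(2 R / η + 2) ^ k` elements. -/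
lemma exists_parameter_cover {α ι : Type*} [Fintype ι] (P : Set α) (q : α → ι → ℝ) {R η : ℝ}
    (hη : 0 < η) (hR : 0 ≤ R) (hq : ∀ a ∈ P, ∀ i, |q a i| ≤ R) :
    ∃ C : Finset α, (∀ c ∈ C, c ∈ P) ∧
      (C.card : ℝ) ≤ (2 * R / η + 2) ^ Fintype.card ι ∧
      ∀ a ∈ P, ∃ c ∈ C, ∀ i, |q a i - q c i| ≤ η := by
  classical
  -- The parameter box is cut into cells of side `η` and one member of `P` is picked from every
  -- occupied cell, so the centres lie in `P`.
  set cell : α → ι → ℕ := fun a i => ⌊(q a i + R) / η⌋₊ with hcell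
  set M : ℕ := ⌊2 * R / η⌋₊ with hM
  set box : Finset (ι → ℕ) := Fintype.piFinset fun _ => Finset.range (M + 1) with hbox
  have hmem : ∀ a ∈ P, cell a ∈ box := by
    intro a ha
    rw [hbox, Fintype.mem_piFinset]
    intro i
    rw [Finset.mem_range, Nat.lt_succ_iff]
    apply Nat.floor_le_floor
    have := (abs_le.mp (hq a ha i)).2
    gcongr
    linarith
  set used := box.filter fun k => ∃ a ∈ P, cell a = k with hused
  have hrep : ∀ k : used, ∃ a ∈ P, cell a = k := fun k => (Finset.mem_filter.mp k.2).2
  choose rep hrepP hrepc using hrep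
  refine ⟨Finset.univ.image rep, ?_, ?_, ?_⟩
  · intro c hc
    obtain ⟨k, -, rfl⟩ := Finset.mem_image.mp hc
    exact hrepP k
  · have h1 : (Finset.univ.image rep).card ≤ (M + 1) ^ Fintype.card ι := by
      calc (Finset.univ.image rep).card ≤ (Finset.univ : Finset used).card :=
            Finset.card_image_le
        _ = used.card := by simp
        _ ≤ box.card := Finset.card_filter_le _ _
        _ = (M + 1) ^ Fintype.card ι := by simp [hbox]
    calc ((Finset.univ.image rep).card : ℝ) ≤ ((M : ℝ) + 1) ^ Fintype.card ι := by
          exact_mod_cast h1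
      _ ≤ _ := by
          gcongr
          · exact Nat.floor_le (by positivity)
          · norm_num
  · intro a ha
    have hk : cell a ∈ used := Finset.mem_filter.mpr ⟨hmem a ha, a, ha, rfl⟩
    refine ⟨rep ⟨cell a, hk⟩, Finset.mem_image_of_mem _ (Finset.mem_univ _), fun i => ?_⟩
    have hc : cell (rep ⟨cell a, hk⟩) i = cell a i := congrFun (hrepc ⟨cell a, hk⟩) i
    have hpos : ∀ a ∈ P, 0 ≤ (q a i + R) / η := fun a ha =>
      div_nonneg (by linarith [(abs_le.mp (hq a ha i)).1]) hη.le
    have e1 := Nat.floor_le (hpos a ha)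
    have e2 := Nat.lt_floor_add_one ((q a i + R) / η)
    have e3 := Nat.floor_le (hpos _ (hrepP ⟨cell a, hk⟩))
    have e4 := Nat.lt_floor_add_one ((q (rep ⟨cell a, hk⟩) i + R) / η)
    simp only [hcell] at hc
    rw [hc] at e3 e4
    have h5 : |(q a i + R) / η - (q (rep ⟨cell a, hk⟩) i + R) / η| ≤ 1 := by
      rw [abs_le]
      constructor <;> linarith
    rw [← sub_div, abs_div, abs_of_pos hη, div_le_one hη] at h5
    simpa using h5

/-! ### The clipped margins of an LSTM class and their covers -/

section Clipped

variable {dx dh K : ℕ}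

/-- The positive part of the margin of the network `i.1`, clipped at the level `i.2`. -/
def clippedMargin (σy : ℝ → ℝ) (t : ℕ) (i : LSTMWeights dx dh K × ℝ)
    (X : Fin t → EuclideanSpace ℝ (Fin dx)) (z : Fin K) : ℝ :=
  min i.2 (max (margin (lstmOutput σy i.1 t X) z) 0)

/-- All parameters of a network together with a clipping level, the latter scaled by `s`. -/
def lstmParams (s : ℝ) (i : LSTMWeights dx dh K × ℝ) :
    ((Fin 4 × Fin dh × Fin dx) ⊕ (Fin 4 × Fin dh × Fin dh)) ⊕ ((Fin K × Fin dh) ⊕ Unit) → ℝ :=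
  Sum.elim
    (Sum.elim (fun k => ![i.1.Wg, i.1.Wr, i.1.Wo, i.1.Wc] k.1 k.2.1 k.2.2)
      fun k => ![i.1.Ug, i.1.Ur, i.1.Uo, i.1.Uc] k.1 k.2.1 k.2.2)
    (Sum.elim (fun k => i.1.V k.1 k.2) fun _ => s * i.2)

lemma abs_lstmParams_le {B : LSTMNormBounds} {Q s Γ : ℝ} (hs : 0 ≤ s) (hsΓ : s * Γ ≤ Q)
    (hQ : B.Wg ≤ Q ∧ B.Wr ≤ Q ∧ B.Wo ≤ Q ∧ B.Wc ≤ Q ∧ B.Ug ≤ Q ∧ B.Ur ≤ Q ∧ B.Uo ≤ Q ∧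
      B.Uc ≤ Q ∧ B.V ≤ Q) {i : LSTMWeights dx dh K × ℝ} (hw : i.1 ∈ lstmClass B dx dh K)
    (h0 : 0 ≤ i.2) (hΓ : i.2 ≤ Γ) (k) : |lstmParams s i k| ≤ Q := by
  obtain ⟨q1, q2, q3, q4, q5, q6, q7, q8, q9⟩ := hQ
  obtain ⟨w1, w2, w3, w4, w5, w6, w7, w8, w9⟩ := hw
  rcases k with (⟨j, a, b⟩ | ⟨j, a, b⟩) | (⟨a, b⟩ | u)
  · fin_cases j
    · exact (abs_entry_le_norm i.1.Wg a b).trans (w1.trans q1)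
    · exact (abs_entry_le_norm i.1.Wr a b).trans (w2.trans q2)
    · exact (abs_entry_le_norm i.1.Wo a b).trans (w3.trans q3)
    · exact (abs_entry_le_norm i.1.Wc a b).trans (w4.trans q4)
  · fin_cases j
    · exact (abs_entry_le_norm i.1.Ug a b).trans (w5.trans q5)
    · exact (abs_entry_le_norm i.1.Ur a b).trans (w6.trans q6)
    · exact (abs_entry_le_norm i.1.Uo a b).trans (w7.trans q7)
    · exact (abs_entry_le_norm i.1.Uc a b).trans (w8.trans q8)
  · exact (abs_entry_le_norm i.1.V a b).trans (w9.trans q9)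
  · have : |s * i.2| ≤ Q := by
      rw [abs_of_nonneg (mul_nonneg hs h0)]
      exact (mul_le_mul_of_nonneg_left hΓ hs).trans hsΓ
    simpa [lstmParams] using this

lemma weightsClose_of_params_close {d : ℕ} (hx : dx ≤ d) (hh : dh ≤ d) (hK : K ≤ d) {s η : ℝ}
    (hη : 0 ≤ η) {i c : LSTMWeights dx dh K × ℝ}
    (h : ∀ k, |lstmParams s i k - lstmParams s c k| ≤ η) : WeightsClose (d * η) i.1 c.1 := by
  refine ⟨?_, ?_, ?_, ?_, ?_, ?_, ?_, ?_, ?_⟩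
  · exact norm_le_of_abs_entry_le hh hx hη fun a b => h (Sum.inl (Sum.inl (0, a, b)))
  · exact norm_le_of_abs_entry_le hh hx hη fun a b => h (Sum.inl (Sum.inl (1, a, b)))
  · exact norm_le_of_abs_entry_le hh hx hη fun a b => h (Sum.inl (Sum.inl (2, a, b)))
  · exact norm_le_of_abs_entry_le hh hx hη fun a b => h (Sum.inl (Sum.inl (3, a, b)))
  · exact norm_le_of_abs_entry_le hh hh hη fun a b => h (Sum.inl (Sum.inr (0, a, b)))
  · exact norm_le_of_abs_entry_le hh hh hη fun a b => h (Sum.inl (Sum.inr (1, a, b)))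
  · exact norm_le_of_abs_entry_le hh hh hη fun a b => h (Sum.inl (Sum.inr (2, a, b)))
  · exact norm_le_of_abs_entry_le hh hh hη fun a b => h (Sum.inl (Sum.inr (3, a, b)))
  · exact norm_le_of_abs_entry_le hK hh hη fun a b => h (Sum.inr (Sum.inl (a, b)))

/-- Nine matrices with at most `d ^ 2` entries each, and one clipping level, counted as `d ^ 2`. -/
lemma card_lstmParams_le {d : ℕ} (hx : dx ≤ d) (hh : dh ≤ d) (hK : K ≤ d) (hd : 1 ≤ d) :
    Fintype.card (((Fin 4 × Fin dh × Fin dx) ⊕ (Fin 4 × Fin dh × Fin dh)) ⊕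
      ((Fin K × Fin dh) ⊕ Unit)) ≤ 10 * d ^ 2 := by
  simp only [Fintype.card_sum, Fintype.card_prod, Fintype.card_fin, Fintype.card_unit]
  have h1 := Nat.mul_le_mul hh hx
  have h2 := Nat.mul_le_mul hh hh
  have h3 := Nat.mul_le_mul hK hh
  have h4 := Nat.mul_le_mul hd hd
  rw [pow_two]
  omega

lemma abs_clippedMargin_sub_le (σy : ℝ → ℝ) (t : ℕ) {i c : LSTMWeights dx dh K × ℝ}
    {X : Fin t → EuclideanSpace ℝ (Fin dx)} {z : Fin K} {ε : ℝ} (h1 : |i.2 - c.2| ≤ ε)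
    (h2 : 2 * ‖lstmOutput σy i.1 t X - lstmOutput σy c.1 t X‖ ≤ ε) :
    |clippedMargin σy t i X z - clippedMargin σy t c X z| ≤ ε := by
  unfold clippedMargin
  refine (abs_min_sub_min_le_max _ _ _ _).trans (max_le h1 ?_)
  refine (abs_max_sub_max_le_max _ _ _ _).trans (max_le ?_ ?_)
  · exact (abs_margin_sub_le _ _ _).trans h2
  · simpa using (abs_nonneg _).trans h1

lemma lipschitz_abs {ρ : ℝ≥0} {σy : ℝ → ℝ} (hσ : LipschitzWith ρ σy) (x y : ℝ) :
    |σy x - σy y| ≤ ρ * |x - y| := by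
  simpa [Real.dist_eq] using hσ.dist_le_mul x y

lemma norm_lstmOutput_sub_le {ρ : ℝ≥0} {σy : ℝ → ℝ} (hσ : LipschitzWith ρ σy) (t : ℕ)
    (w w' : LSTMWeights dx dh K) (X : Fin t → EuclideanSpace ℝ (Fin dx)) :
    ‖lstmOutput σy w t X - lstmOutput σy w' t X‖ ≤
      ρ * (‖w.V‖ * ‖(lstmState w t X).2 - (lstmState w' t X).2‖ + ‖w.V - w'.V‖ * √(dh : ℝ)) := by
  refine (norm_entrywise_sub_le ρ.2 (lipschitz_abs hσ) _ _).trans ?_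
  refine mul_le_mul_of_nonneg_left ?_ ρ.2
  have e : Matrix.toEuclideanLin w.V (lstmState w t X).2 -
      Matrix.toEuclideanLin w'.V (lstmState w' t X).2 =
      Matrix.toEuclideanLin w.V ((lstmState w t X).2 - (lstmState w' t X).2) +
        Matrix.toEuclideanLin (w.V - w'.V) (lstmState w' t X).2 := by
    simp only [map_sub, LinearMap.sub_apply]
    abel
  rw [e]
  refine (norm_add_le _ _).trans (add_le_add (norm_toEuclideanLin_le _ _) ?_)
  exact (norm_toEuclideanLin_le _ _).trans
    (mul_le_mul_of_nonneg_left (norm_hidden_le_sqrt w' t X) (norm_nonneg _))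

/-- The bound for the hidden state that enters the rate. -/
def hiddenBound (B : LSTMNormBounds) (Bx : ℝ) (t : ℕ) (w : LSTMWeights dx dh K) : ℝ :=
  min (√((max dx (max K dh) : ℕ) : ℝ)) (B.Wc * Bx * geomRatio (lstmBeta B Bx t w) t)

lemma abs_margin_lstmOutput_le {B : LSTMNormBounds} {Bx : ℝ} (hBx : 0 ≤ Bx) {ρ : ℝ≥0}
    {σy : ℝ → ℝ} (hσ : LipschitzWith ρ σy) (hσ0 : σy 0 = 0) {w : LSTMWeights dx dh K}
    (hw : w ∈ lstmClass B dx dh K) (t : ℕ) {X : Fin t → EuclideanSpace ℝ (Fin dx)}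
    (hX : ∀ i, ‖X i‖ ≤ Bx) (z : Fin K) :
    |margin (lstmOutput σy w t X) z| ≤ 2 * (ρ * B.V * hiddenBound B Bx t w) := by
  obtain ⟨-, -, -, hWc, -, -, -, hUc, hV⟩ := hw
  have hV0 : 0 ≤ B.V := (norm_nonneg _).trans hV
  have h1 := abs_margin_sub_le (lstmOutput σy w t X) 0 z
  rw [margin_zero, sub_zero, sub_zero] at h1
  refine h1.trans (mul_le_mul_of_nonneg_left ?_ zero_le_two)
  refine (norm_entrywise_le ρ.2 (lipschitz_abs hσ) hσ0 _).trans ?_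
  rw [mul_assoc]
  refine mul_le_mul_of_nonneg_left ((norm_toEuclideanLin_le _ _).trans ?_) ρ.2
  refine mul_le_mul hV ?_ (norm_nonneg _) hV0
  refine le_min ((norm_hidden_le_sqrt w t X).trans (Real.sqrt_le_sqrt ?_))
    (norm_hidden_le hBx hWc hUc t hX)
  exact_mod_cast le_max_of_le_right (le_max_right K dh)

end Clipped

/-- A finite internal cover of the clipped margins, of cardinality polynomial in the sample size
and the dimension with exponent `10 d ^ 2`. -/
theorem exists_clippedMargin_cover (B : LSTMNormBounds) (Bx : ℝ) (t : ℕ) (hBx : 0 ≤ Bx)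
    (hV : 0 < B.V) {μ : ℝ} (hμ : 0 < μ) :
    ∃ k₀ : ℝ, 2 ≤ k₀ ∧ ∀ (dx dh K d m : ℕ) (ρ : ℝ≥0) (σy : ℝ → ℝ), dx ≤ d → dh ≤ d → K ≤ d →
      1 ≤ d → 0 < m → 0 < ρ → LipschitzWith ρ σy →
      ∃ C : Finset (LSTMWeights dx dh K × ℝ),
        (∀ c ∈ C, c.1 ∈ lstmClass B dx dh K ∧ 0 ≤ c.2 ∧ c.2 ≤ 2 * (ρ * B.V * √(d : ℝ))) ∧
        (C.card : ℝ) ≤ (k₀ * ((d : ℝ) ^ 2 * √(m : ℝ))) ^ (10 * d ^ 2) ∧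
        ∀ i : LSTMWeights dx dh K × ℝ, i.1 ∈ lstmClass B dx dh K → 0 ≤ i.2 →
          i.2 ≤ 2 * (ρ * B.V * √(d : ℝ)) →
          ∃ c ∈ C, ∀ X : Fin t → EuclideanSpace ℝ (Fin dx), (∀ j, ‖X j‖ ≤ Bx) → ∀ z,
            |clippedMargin σy t i X z - clippedMargin σy t c X z| ≤
              ρ * B.V * μ / √(m : ℝ) := by
  -- Absolute values, because apart from `B.V` the bounds may be negative here (the class is then
  -- empty).
  set Q : ℝ := |B.Wg| + |B.Wr| + |B.Wo| + |B.Wc| + |B.Ug| + |B.Ur| + |B.Uo| + |B.Uc| + |B.V| + 1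
    with hQdef
  have a1 := abs_nonneg B.Wg
  have a2 := abs_nonneg B.Wr
  have a3 := abs_nonneg B.Wo
  have a4 := abs_nonneg B.Wc
  have a5 := abs_nonneg B.Ug
  have a6 := abs_nonneg B.Ur
  have a7 := abs_nonneg B.Uo
  have a8 := abs_nonneg B.Uc
  have a9 := abs_nonneg B.V
  have hQ : B.Wg ≤ Q ∧ B.Wr ≤ Q ∧ B.Wo ≤ Q ∧ B.Wc ≤ Q ∧ B.Ug ≤ Q ∧ B.Ur ≤ Q ∧ B.Uo ≤ Q ∧
      B.Uc ≤ Q ∧ B.V ≤ Q := by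
    refine ⟨?_, ?_, ?_, ?_, ?_, ?_, ?_, ?_, ?_⟩
    · linarith [le_abs_self B.Wg]
    · linarith [le_abs_self B.Wr]
    · linarith [le_abs_self B.Wo]
    · linarith [le_abs_self B.Wc]
    · linarith [le_abs_self B.Ug]
    · linarith [le_abs_self B.Ur]
    · linarith [le_abs_self B.Uo]
    · linarith [le_abs_self B.Uc]
    · linarith [le_abs_self B.V]
  have hQ1 : 1 ≤ Q := by linarith
  obtain ⟨L, hL, hLip⟩ := exists_lipschitz_lstmState Q Bx (by linarith) hBx t
  -- The first bound keeps the rescaled clipping level inside `[-Q, Q]`; the second makes twice the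
  -- output error at most `ε`.
  set κ : ℝ := min (μ / 2) (B.V * μ / (2 * (2 * L * B.V + 1))) with hκdef
  have hden : 0 < 2 * (2 * L * B.V + 1) := by positivity
  have hκ : 0 < κ := lt_min (by positivity) (by positivity)
  refine ⟨2 * Q / κ + 2, by linarith [div_nonneg (by linarith : 0 ≤ 2 * Q) hκ.le], ?_⟩
  intro dx dh K d m ρ σy hx hh hK hd hm hρ hσ
  have hm1 : (1 : ℝ) ≤ √(m : ℝ) := by
    rw [Real.one_le_sqrt]
    exact_mod_cast hm
  have hd1 : (1 : ℝ) ≤ d := by exact_mod_cast hd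
  have hsd1 : (1 : ℝ) ≤ √(d : ℝ) := by rwa [Real.one_le_sqrt]
  have hsd : √(d : ℝ) * √(d : ℝ) = d := Real.mul_self_sqrt (by positivity)
  have hsdd : √(d : ℝ) ≤ d := 
    (le_mul_of_one_le_left (Real.sqrt_nonneg _) hsd1).trans_eq hsd
  have hρ' : (0 : ℝ) < ρ := hρ
  have hm0 : 0 < √(m : ℝ) := by linarith
  have hd0 : (0 : ℝ) < d := by linarith
  -- One factor `d` pays for passing from entries to spectral norms, the other for the factors `1 +
  -- √dh` and `√dh` in the Lipschitz bounds.
  set η : ℝ := κ / ((d : ℝ) ^ 2 * √(m : ℝ)) with hη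
  set ε : ℝ := ρ * B.V * μ / √(m : ℝ) with hε
  have hη0 : 0 < η := by positivity
  have hε0 : 0 < ε := by positivity
  have hη1 : η * ((d : ℝ) ^ 2 * √(m : ℝ)) = κ := by
    rw [hη]
    field_simp
  have hε1 : ε * √(m : ℝ) = ρ * B.V * μ := by
    rw [hε]
    field_simp
  set Γ : ℝ := 2 * (ρ * B.V * √(d : ℝ)) with hΓ
  -- Scaling the level by `η / ε` lets a grid of mesh `η` resolve it to precision `ε`.
  have hsΓ : η / ε * Γ ≤ Q := by
    have h1 : η / ε * Γ = 2 * √(d : ℝ) * κ / ((d : ℝ) ^ 2 * μ) := by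
      rw [hη, hε, hΓ]
      field_simp
    rw [h1, div_le_iff₀ (by positivity)]
    have h2 : κ ≤ μ / 2 := min_le_left _ _
    have h3 : √(d : ℝ) ≤ (d : ℝ) ^ 2 := hsdd.trans (le_self_pow₀ hd1 two_ne_zero)
    calc 2 * √(d : ℝ) * κ ≤ 2 * (d : ℝ) ^ 2 * (μ / 2) := by gcongr
      _ = 1 * ((d : ℝ) ^ 2 * μ) := by ring
      _ ≤ Q * ((d : ℝ) ^ 2 * μ) := by gcongr
  obtain ⟨C, hC1, hC2, hC3⟩ := exists_parameter_cover
    {i : LSTMWeights dx dh K × ℝ | i.1 ∈ lstmClass B dx dh K ∧ 0 ≤ i.2 ∧ i.2 ≤ Γ}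
    (lstmParams (η / ε)) hη0 (by linarith : 0 ≤ Q)
    (fun i hi k => abs_lstmParams_le (by positivity) hsΓ hQ hi.1 hi.2.1 hi.2.2 k)
  refine ⟨C, hC1, hC2.trans ?_, ?_⟩
  · have h1 : (1 : ℝ) ≤ (d : ℝ) ^ 2 * √(m : ℝ) :=
      one_le_mul_of_one_le_of_one_le (one_le_pow₀ hd1) hm1
    have h2 : 2 * Q / η + 2 ≤ (2 * Q / κ + 2) * ((d : ℝ) ^ 2 * √(m : ℝ)) := by
      have : 2 * Q / η = 2 * Q / κ * ((d : ℝ) ^ 2 * √(m : ℝ)) := by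
        rw [hη]
        field_simp
      rw [this, add_mul]
      linarith
    have h3 : (1 : ℝ) ≤ 2 * Q / η + 2 := by
      have : 0 ≤ 2 * Q / η := by positivity
      linarith
    exact (pow_le_pow_right₀ h3 (card_lstmParams_le hx hh hK hd)).trans
      (pow_le_pow_left₀ (by linarith) h2 _)
  · intro i hi hi0 hiΓ
    obtain ⟨c, hc, hclose⟩ := hC3 i ⟨hi, hi0, hiΓ⟩
    refine ⟨c, hc, fun X hX z => abs_clippedMargin_sub_le σy t ?_ ?_⟩
    · have h1 := hclose (Sum.inr (Sum.inr ()))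
      simp only [lstmParams, Sum.elim_inr] at h1
      rw [← mul_sub, abs_mul, abs_of_pos (div_pos hη0 hε0), div_mul_eq_mul_div,
        div_le_iff₀ hε0] at h1
      exact le_of_mul_le_mul_left h1 hη0
    · have hwc := weightsClose_of_params_close hx hh hK hη0.le hclose
      obtain ⟨q1, q2, q3, q4, q5, q6, q7, q8, q9⟩ := hQ
      have hi' := hi
      obtain ⟨w1, w2, w3, w4, w5, w6, w7, w8, w9⟩ := hi'
      have h1 := hLip dx dh K i.1 c.1 (d * η) (by positivity) (w5.trans q5) (w6.trans q6)
        (w7.trans q7) (w8.trans q8) hwc X hX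
      have h2 := norm_lstmOutput_sub_le hσ t i.1 c.1 X
      have hdh : √(dh : ℝ) ≤ √(d : ℝ) := Real.sqrt_le_sqrt (by exact_mod_cast hh)
      have h3 : ‖(lstmState i.1 t X).2 - (lstmState c.1 t X).2‖ ≤ L * (d * η * (2 * d)) := by
        have : L * (d * η * (1 + √(dh : ℝ))) ≤ L * (d * η * (2 * d)) := by
          gcongr
          linarith
        linarith [norm_nonneg ((lstmState i.1 t X).1 - (lstmState c.1 t X).1)]
      have h4 : ‖i.1.V - c.1.V‖ * √(dh : ℝ) ≤ d * η * d :=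
        mul_le_mul hwc.2.2.2.2.2.2.2.2 (hdh.trans hsdd) (Real.sqrt_nonneg _) (by positivity)
      have h5 : ‖i.1.V‖ * ‖(lstmState i.1 t X).2 - (lstmState c.1 t X).2‖ ≤
          B.V * (L * (d * η * (2 * d))) := mul_le_mul w9 h3 (norm_nonneg _) hV.le
      have h6 : (2 * (2 * L * B.V + 1)) * κ ≤ B.V * μ := by
        have : κ ≤ B.V * μ / (2 * (2 * L * B.V + 1)) := min_le_right _ _
        rw [le_div_iff₀ hden] at this
        linarith
      calc 2 * ‖lstmOutput σy i.1 t X - lstmOutput σy c.1 t X‖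
          ≤ 2 * (ρ * (B.V * (L * (d * η * (2 * d))) + d * η * d)) := by
            refine mul_le_mul_of_nonneg_left (h2.trans ?_) zero_le_two
            exact mul_le_mul_of_nonneg_left (add_le_add h5 h4) hρ'.le
        _ = ρ * ((2 * (2 * L * B.V + 1)) * (η * ((d : ℝ) ^ 2 * √(m : ℝ)))) / √(m : ℝ) := by
            field_simp
        _ ≤ ρ * (B.V * μ) / √(m : ℝ) := by
            rw [hη1]
            gcongr
        _ = ε := by rw [hε, mul_assoc]

/-! ### From deviations of clipped margins to the misclassification probability -/

section Risk

variable {dx dh K T : ℕ}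

lemma clippedMargin_nonneg {σy : ℝ → ℝ} {t : ℕ} {i : LSTMWeights dx dh K × ℝ} (hi : 0 ≤ i.2)
    (X : Fin t → EuclideanSpace ℝ (Fin dx)) (z : Fin K) : 0 ≤ clippedMargin σy t i X z :=
  le_min hi (le_max_right _ _)

lemma measurable_clippedMargin {σy : ℝ → ℝ} (hσ : Continuous σy) (t : ℕ)
    (i : LSTMWeights dx dh K × ℝ) :
    Measurable fun q : (Fin t → EuclideanSpace ℝ (Fin dx)) × Fin K =>
      clippedMargin σy t i q.1 q.2 := by
  refine measurable_from_prod_countable_left fun z => Continuous.measurable ?_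
  exact continuous_const.min
    (((continuous_margin z).comp (continuous_lstmOutput hσ i.1 t)).max continuous_const)

lemma measurable_inputPrefix {t : ℕ} (ht : t ≤ T) :
    Measurable fun p : LabeledSeq dx K T => inputPrefix t ht p :=
  measurable_pi_lambda _ fun i => (measurable_pi_apply (Fin.castLE ht i)).fst

lemma measurable_labelAt {t : ℕ} (ht1 : 1 ≤ t) (ht : t ≤ T) :
    Measurable fun p : LabeledSeq dx K T => labelAt t ht1 ht p :=
  (measurable_pi_apply (⟨t - 1, by omega⟩ : Fin T)).snd

lemma measurable_clippedMargin_seq {σy : ℝ → ℝ} (hσ : Continuous σy) {t : ℕ} (ht1 : 1 ≤ t)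
    (ht : t ≤ T) (i : LSTMWeights dx dh K × ℝ) :
    Measurable fun p : LabeledSeq dx K T =>
      clippedMargin σy t i (inputPrefix t ht p) (labelAt t ht1 ht p) := by
  have h1 : Measurable fun p : LabeledSeq dx K T => (inputPrefix t ht p, labelAt t ht1 ht p) :=
    (measurable_inputPrefix ht).prodMk (measurable_labelAt ht1 ht)
  have h2 := measurable_clippedMargin hσ t i
  generalize clippedMargin σy t i = f at h2 ⊢
  exact h2.comp h1

/-- The clipped margin `F` vanishes on misclassified points, and the indicator of `F = 0` is at most
`1 - F / γ` because `0 ≤ F ≤ c ≤ γ`. -/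
lemma misclassProb_le {σy : ℝ → ℝ} (hσ : Continuous σy)
    {φ : EuclideanSpace ℝ (Fin K) → Fin K}
    (hφ : ∀ (y : EuclideanSpace ℝ (Fin K)) (j : Fin K), y j ≤ y (φ y)) {t : ℕ} (ht1 : 1 ≤ t)
    (ht : t ≤ T) (D : Measure (LabeledSeq dx K T)) [IsProbabilityMeasure D] {γ c : ℝ}
    (hγ : 0 < γ) (hc0 : 0 ≤ c) (hc : c ≤ γ) (w : LSTMWeights dx dh K) :
    misclassProb σy φ t ht1 ht D w ≤
      1 - (∫ p, clippedMargin σy t (w, c) (inputPrefix t ht p) (labelAt t ht1 ht p) ∂D) / γ := by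
  set F : LabeledSeq dx K T → ℝ := fun p =>
    clippedMargin σy t (w, c) (inputPrefix t ht p) (labelAt t ht1 ht p) with hF
  have hFm : Measurable F := measurable_clippedMargin_seq hσ ht1 ht (w, c)
  have hF0 : ∀ p, 0 ≤ F p := fun p => clippedMargin_nonneg hc0 _ _
  have hFc : ∀ p, F p ≤ c := fun p => min_le_left _ _
  have hint : Integrable F D :=
    Integrable.of_mem_Icc 0 c hFm.aemeasurable (Filter.Eventually.of_forall fun p =>
      ⟨hF0 p, hFc p⟩)
  have hZ : MeasurableSet {p | F p = 0} := hFm (measurableSet_singleton 0)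
  -- As `φ` is an arbitrary choice of maximiser, the misclassification event need not be measurable;
  -- it is enclosed in a measurable one.
  have h1 : misclassProb σy φ t ht1 ht D w ≤ D.real {p | F p = 0} := by
    refine measureReal_mono fun p hp => ?_
    have h := margin_nonpos_of_misclassified hφ hp
    show min c (max _ 0) = 0
    rw [max_eq_right h, min_eq_right hc0]
  have h2 : D.real {p | F p = 0} = ∫ p, Set.indicator {p | F p = 0} 1 p ∂D := by
    rw [integral_indicator_one hZ]
  have h3 : ∫ p, Set.indicator {p | F p = 0} 1 p ∂D ≤ ∫ p, (1 - F p / γ) ∂D := by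
    apply integral_mono
    · exact (integrable_const (1 : ℝ)).indicator hZ
    · exact (integrable_const 1).sub (hint.div_const γ)
    · intro p
      by_cases hp : F p = 0
      · rw [Set.indicator_of_mem (s := {p | F p = 0}) hp]
        simp [hp]
      · rw [Set.indicator_of_notMem (s := {p | F p = 0}) hp]
        have : F p / γ ≤ 1 := by
          rw [div_le_one hγ]
          exact (hFc p).trans hc
        simpa using this
  have h4 : ∫ p, (1 - F p / γ) ∂D = 1 - (∫ p, F p ∂D) / γ := by
    rw [integral_sub (integrable_const 1) (hint.div_const γ), integral_div]
    simp
  linarith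

/-- No margin exceeds `Γ`, so clipping at `min γ Γ` is the same as clipping at `γ`. Hence levels in
the compact interval `[0, Γ]` serve every `γ > 0`. -/
lemma empRampRisk_eq {σy : ℝ → ℝ} {γ Γ : ℝ} (hγ : 0 < γ) {t : ℕ} (ht1 : 1 ≤ t) (ht : t ≤ T)
    {m : ℕ} (hm : 0 < m) {S : Fin m → LabeledSeq dx K T} {w : LSTMWeights dx dh K}
    (hΓ0 : 0 ≤ Γ)
    (hΓ : ∀ j, margin (lstmOutput σy w t (inputPrefix t ht (S j))) (labelAt t ht1 ht (S j)) ≤ Γ) :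
    empRampRisk σy γ t ht1 ht S w = 1 - ((1 / (m : ℝ)) * ∑ j, clippedMargin σy t (w, min γ Γ)
      (inputPrefix t ht (S j)) (labelAt t ht1 ht (S j))) / γ := by
  have hm' : (0 : ℝ) < m := by exact_mod_cast hm
  unfold empRampRisk
  have h : ∀ j, rampLoss γ
      (-margin (lstmOutput σy w t (inputPrefix t ht (S j))) (labelAt t ht1 ht (S j))) =
      1 - clippedMargin σy t (w, min γ Γ) (inputPrefix t ht (S j)) (labelAt t ht1 ht (S j)) / γ := by
    intro j
    rw [rampLoss_neg hγ, clippedMargin, min_assoc, min_eq_right (max_le (hΓ j) hΓ0)]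
  simp only [h]
  rw [Finset.sum_sub_distrib, ← Finset.sum_div]
  simp only [Finset.sum_const, Finset.card_univ, Fintype.card_fin, nsmul_eq_mul, mul_one]
  field_simp

lemma empRampRisk_nonneg {σy : ℝ → ℝ} {γ : ℝ} (hγ : 0 < γ) {t : ℕ} (ht1 : 1 ≤ t) (ht : t ≤ T)
    {m : ℕ} (S : Fin m → LabeledSeq dx K T) (w : LSTMWeights dx dh K) :
    0 ≤ empRampRisk σy γ t ht1 ht S w := by
  unfold empRampRisk
  refine mul_nonneg (by positivity) (Finset.sum_nonneg fun j _ => ?_)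
  rw [rampLoss_neg hγ, sub_nonneg, div_le_one hγ]
  exact min_le_left _ _

lemma misclassProb_le_one (σy : ℝ → ℝ) (φ : EuclideanSpace ℝ (Fin K) → Fin K) {t : ℕ}
    (ht1 : 1 ≤ t) (ht : t ≤ T) (D : Measure (LabeledSeq dx K T)) [IsProbabilityMeasure D]
    (w : LSTMWeights dx dh K) : misclassProb σy φ t ht1 ht D w ≤ 1 :=
  measureReal_le_one

end Risk

/-! ### The rate and the arithmetic of the constants -/

section Rate

variable {dx dh K : ℕ}

lemma lstmRate_eq (B : LSTMNormBounds) (Bx ρ : ℝ) (t m : ℕ) (γ : ℝ) (w : LSTMWeights dx dh K) :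
    lstmRate B Bx ρ t m γ w = ((max dx (max K dh) : ℕ) : ℝ) *
      (ρ * B.V * hiddenBound B Bx t w / γ) *
      √(Real.log (geomRatio (lstmTheta B Bx t w) t * ((max dx (max K dh) : ℕ) : ℝ) * √(m : ℝ))) /
        √(m : ℝ) := by
  simp only [lstmRate, hiddenBound, div_eq_mul_inv, mul_inv]
  ring

/-- A lower bound free of the network and the dimensions: the resolution of the cover, fixed in
advance from it, is then absorbed in the rate of every network. -/
lemma hiddenBound_ge {B : LSTMNormBounds} {Bx : ℝ} (hBx : 0 ≤ Bx) {t : ℕ} (ht1 : 1 ≤ t)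
    (hK : 1 ≤ K) {w : LSTMWeights dx dh K} (hw : w ∈ lstmClass B dx dh K) :
    min 1 (B.Wc * Bx) ≤ hiddenBound B Bx t w := by
  obtain ⟨-, -, -, hWc, -, -, -, hUc, -⟩ := hw
  have hWc0 : 0 ≤ B.Wc := (norm_nonneg _).trans hWc
  have hUc0 : 0 ≤ B.Uc := (norm_nonneg _).trans hUc
  refine min_le_min ?_ ?_
  · rw [Real.one_le_sqrt]
    exact_mod_cast le_max_of_le_right (le_max_of_le_left hK)
  · exact le_mul_of_one_le_right (mul_nonneg hWc0 hBx)
      (one_le_geomRatio (lstmBeta_nonneg hUc0 Bx t w) ht1)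

lemma hiddenBound_nonneg {B : LSTMNormBounds} {Bx : ℝ} (hBx : 0 ≤ Bx) {t : ℕ} (ht1 : 1 ≤ t)
    (hK : 1 ≤ K) {w : LSTMWeights dx dh K} (hw : w ∈ lstmClass B dx dh K) :
    0 ≤ hiddenBound B Bx t w := by
  refine le_trans (le_min zero_le_one (mul_nonneg ?_ hBx)) (hiddenBound_ge hBx ht1 hK hw)
  exact (norm_nonneg _).trans hw.2.2.2.1

lemma lstmRate_nonneg {B : LSTMNormBounds} {Bx : ℝ} (hBx : 0 ≤ Bx) (ρ : ℝ≥0) {t : ℕ}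
    (ht1 : 1 ≤ t) (m : ℕ) {γ : ℝ} (hγ : 0 < γ) (hK : 1 ≤ K) {w : LSTMWeights dx dh K}
    (hw : w ∈ lstmClass B dx dh K) : 0 ≤ lstmRate B Bx ρ t m γ w := by
  have h1 := hiddenBound_nonneg hBx ht1 hK hw
  have h2 : 0 ≤ B.V := (norm_nonneg _).trans hw.2.2.2.2.2.2.2.2
  rw [lstmRate_eq]
  positivity

/-- The logarithm in the rate dominates `log (d √m)`. -/
lemma log_le_log_rate {B : LSTMNormBounds} {Bx : ℝ} {t : ℕ} (ht1 : 1 ≤ t)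
    {w : LSTMWeights dx dh K} (hw : w ∈ lstmClass B dx dh K) {x y : ℝ} (hx : 0 < x)
    (hy : 0 < y) :
    Real.log (x * y) ≤ Real.log (geomRatio (lstmTheta B Bx t w) t * x * y) := by
  obtain ⟨-, -, -, -, hUg, hUr, hUo, hUc, -⟩ := hw
  have h1 := lstmBeta_nonneg ((norm_nonneg _).trans hUc) Bx t w
  have h2 : 0 ≤ lstmTheta B Bx t w := by
    unfold lstmTheta
    linarith [(norm_nonneg _).trans hUg, (norm_nonneg _).trans hUr, (norm_nonneg _).trans hUo]
  apply Real.log_le_log (by positivity)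
  rw [mul_assoc]
  exact le_mul_of_one_le_left (by positivity) (one_le_geomRatio h2 ht1)

end Rate

lemma sqrt_add_le {x y : ℝ} (hx : 0 ≤ x) (hy : 0 ≤ y) : √(x + y) ≤ √x + √y := by
  refine Real.sqrt_le_iff.mpr ⟨by positivity, ?_⟩
  rw [add_sq, Real.sq_sqrt hx, Real.sq_sqrt hy]
  have : 0 ≤ √x * √y := by positivity
  linarith

/-- The arithmetic that turns the uniform deviation bound into the stated rate. -/
lemma deviation_le_rate {d m v Λ a N e b δ : ℝ} (hd : 2 ≤ d) (hm : 1 ≤ m) (hv : 0 ≤ v)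
    (hΛ : 1 / 2 ≤ Λ) (hN : 1 ≤ N) (hNa : Real.log N ≤ a * d ^ 2 * Λ) (he0 : 0 ≤ e)
    (he : e ≤ v / √m) (hb0 : 0 ≤ b) (hbv : b ≤ 2 * v) (hb1 : b ≤ 1) (hδ0 : 0 < δ) (hδ1 : δ < 1)
    (hs : 3 * √(Real.log (2 / δ) / (2 * m)) < 1) :
    2 * e + (b + 2 * e) * √(Real.log (N / δ) / (2 * m)) ≤
      3 * √(Real.log (2 / δ) / (2 * m)) + (4 + 4 * √(a / 2)) * (d * v * √Λ / √m) := by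
  have hm0 : 0 < m := by linarith
  have hm1 : 1 ≤ √m := by rwa [Real.one_le_sqrt]
  set s := √(Real.log (2 / δ) / (2 * m)) with hsdef
  set r := √Λ / √m with hr
  have hr0 : 0 ≤ r := by positivity
  have hs0 : 0 ≤ s := Real.sqrt_nonneg _
  have hlogN : 0 ≤ Real.log N := Real.log_nonneg hN
  -- Complexity and confidence are separated: `log (N / δ) = log N + log (1 / δ)`.
  have h1 : √(Real.log (N / δ) / (2 * m)) ≤ √(Real.log N / (2 * m)) + s := by
    have e1 : Real.log (N / δ) / (2 * m) = Real.log N / (2 * m) + Real.log (1 / δ) / (2 * m) := by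
      rw [← add_div, ← Real.log_mul (by linarith) (by positivity)]
      ring_nf
    rw [e1]
    refine (sqrt_add_le (by positivity) ?_).trans (add_le_add le_rfl (Real.sqrt_le_sqrt ?_))
    · exact div_nonneg (Real.log_nonneg (one_le_one_div hδ0 hδ1.le)) (by linarith)
    gcongr
    norm_num
  have h2 : √(Real.log N / (2 * m)) ≤ √(a / 2) * (d * r) := by
    have e2 : √(a / 2) * (d * r) = √(a / 2 * (d ^ 2 * (Λ / m))) := by
      rw [Real.sqrt_mul' _ (by positivity), Real.sqrt_mul (by positivity) (Λ / m),
        Real.sqrt_sq (by linarith), hr, Real.sqrt_div (by linarith) m]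
    rw [e2]
    apply Real.sqrt_le_sqrt
    rw [div_le_iff₀ (by positivity)]
    calc Real.log N ≤ a * d ^ 2 * Λ := hNa
      _ = _ := by field_simp
  -- The discretisation error carries no logarithm; `d ≥ 2` and `√Λ ≥ 1 / 2` supply the missing
  -- factor `d √Λ ≥ 1`.
  have h3 : v / √m ≤ d * v * r := by
    have h4 : 1 / 2 ≤ √Λ := by
      apply Real.le_sqrt_of_sq_le
      norm_num
      linarith
    have h5 : 1 ≤ d * √Λ := by nlinarith
    calc v / √m = 1 * (v / √m) := by ring
      _ ≤ d * √Λ * (v / √m) := mul_le_mul_of_nonneg_right h5 (by positivity)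
      _ = d * v * r := by rw [hr]; ring
  have h6 : v / √m ≤ v := div_le_self hv hm1
  have e3 : d * v * √Λ / √m = d * v * r := by rw [hr]; ring
  rw [e3]
  set q := √(Real.log N / (2 * m)) with hq
  have hq0 : 0 ≤ q := Real.sqrt_nonneg _
  have h7 : (b + 2 * e) * √(Real.log (N / δ) / (2 * m)) ≤ (b + 2 * e) * (q + s) :=
    mul_le_mul_of_nonneg_left h1 (by linarith)
  have h8 : (b + 2 * e) * q ≤ 4 * v * (√(a / 2) * (d * r)) :=
    mul_le_mul (by linarith) h2 hq0 (by linarith)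
  -- Here `b ≤ 1` and `s < 1` are used. The two terms `2 e` give the constant `4`, and `b + 2 e ≤ 4
  -- v` gives `4 √(a / 2)`.
  have h9 : (b + 2 * e) * s ≤ s + 2 * e := by
    have h10 : b * s ≤ 1 * s := mul_le_mul_of_nonneg_right hb1 hs0
    have h11 : e * s ≤ e * 1 := mul_le_mul_of_nonneg_left (by linarith) he0
    linarith
  have h12 : (4 + 4 * √(a / 2)) * (d * v * r) =
      4 * (d * v * r) + 4 * v * (√(a / 2) * (d * r)) := by ring
  linarith

/-- When the bound on the hidden states vanishes the empirical ramp risk is `1`, so nothing is to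
be proved for inputs that obey the norm bound. -/
lemma empRampRisk_eq_one_of_degenerate {dx dh K T : ℕ} {B : LSTMNormBounds} {Bx : ℝ}
    (hBx : 0 ≤ Bx) {ρ : ℝ≥0} {σy : ℝ → ℝ} (hσ : LipschitzWith ρ σy) (hσ0 : σy 0 = 0)
    {w : LSTMWeights dx dh K} (hw : w ∈ lstmClass B dx dh K) {t : ℕ} (ht1 : 1 ≤ t) (ht : t ≤ T)
    (hdeg : (ρ : ℝ) * B.V * hiddenBound B Bx t w = 0) {m : ℕ} (hm : 0 < m) {γ : ℝ} (hγ : 0 < γ)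
    {S : Fin m → LabeledSeq dx K T} (hS : ∀ j, ∀ i : Fin T, ‖(S j i).1‖ ≤ Bx) :
    empRampRisk σy γ t ht1 ht S w = 1 := by
  have hm' : (0 : ℝ) < m := by exact_mod_cast hm
  have h : ∀ j, rampLoss γ
      (-margin (lstmOutput σy w t (inputPrefix t ht (S j))) (labelAt t ht1 ht (S j))) = 1 := by
    intro j
    have h1 := abs_margin_lstmOutput_le hBx hσ hσ0 hw t (X := inputPrefix t ht (S j))
      (fun i => hS j _) (labelAt t ht1 ht (S j))
    rw [hdeg, mul_zero, abs_nonpos_iff] at h1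
    rw [h1, rampLoss_neg hγ]
    simp [hγ.le]
  unfold empRampRisk
  simp only [h]
  simp
  field_simp

/-- The logarithm of the cover size, first with a constant depending on the cover and then, for
large samples, with an absolute one. -/
lemma log_cover_le {k₀ : ℝ} (hk : 2 ≤ k₀) {d m : ℕ} (hd : 2 ≤ d) (hm : 0 < m) {Λ : ℝ}
    (hΛ : Real.log (d * √(m : ℝ)) ≤ Λ) :
    Real.log ((k₀ * ((d : ℝ) ^ 2 * √(m : ℝ))) ^ (10 * d ^ 2)) ≤
        20 * (Real.log k₀ + 1) * (d : ℝ) ^ 2 * Λ ∧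
      (k₀ ≤ √(m : ℝ) → Real.log ((k₀ * ((d : ℝ) ^ 2 * √(m : ℝ))) ^ (10 * d ^ 2)) ≤
        30 * (d : ℝ) ^ 2 * Λ) ∧ 1 / 2 ≤ Λ := by
  have hm1 : (1 : ℝ) ≤ √(m : ℝ) := by
    rw [Real.one_le_sqrt]
    exact_mod_cast hm
  have hd2 : (2 : ℝ) ≤ d := by exact_mod_cast hd
  have hdm : (2 : ℝ) ≤ d * √(m : ℝ) := by nlinarith
  have hΛ2 : 1 / 2 ≤ Λ := by
    have h1 := Real.log_le_log two_pos hdm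
    have h2 := Real.log_two_gt_d9
    linarith
  have hk0 : 0 ≤ Real.log k₀ := Real.log_nonneg (by linarith)
  -- Since `√m ≥ 1`, `d ^ 2 √m ≤ (d √m) ^ 2`, whose logarithm is at most `2 Λ`. Afterwards `log k₀`
  -- is absorbed through `1 ≤ 2 Λ`, or through `log k₀ ≤ Λ` when `k₀ ≤ √m`.
  have e : Real.log ((k₀ * ((d : ℝ) ^ 2 * √(m : ℝ))) ^ (10 * d ^ 2)) ≤
      10 * (d : ℝ) ^ 2 * (Real.log k₀ + 2 * Λ) := by
    rw [Real.log_pow, Real.log_mul (by positivity) (by positivity)]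
    push_cast
    refine mul_le_mul_of_nonneg_left (add_le_add le_rfl ?_) (by positivity)
    have h1 : Real.log ((d : ℝ) ^ 2 * √(m : ℝ)) ≤ Real.log ((d * √(m : ℝ)) ^ 2) := by
      apply Real.log_le_log (by positivity)
      rw [mul_pow]
      gcongr
      exact le_self_pow₀ hm1 two_ne_zero
    rw [Real.log_pow] at h1
    push_cast at h1
    linarith
  refine ⟨e.trans ?_, fun hkm => e.trans ?_, hΛ2⟩
  · have h1 : Real.log k₀ ≤ 2 * Real.log k₀ * Λ := by nlinarith
    calc 10 * (d : ℝ) ^ 2 * (Real.log k₀ + 2 * Λ)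
        ≤ 10 * (d : ℝ) ^ 2 * (2 * Real.log k₀ * Λ + 2 * Λ) := by gcongr
      _ = _ := by ring
  · have h1 : Real.log k₀ ≤ Λ := by
      refine (Real.log_le_log (by linarith) (hkm.trans ?_)).trans hΛ
      exact le_mul_of_one_le_left (by linarith) (by linarith)
    calc 10 * (d : ℝ) ^ 2 * (Real.log k₀ + 2 * Λ)
        ≤ 10 * (d : ℝ) ^ 2 * (Λ + 2 * Λ) := by gcongr
      _ = _ := by ring

/-- The risk bound for one network and one margin parameter, on a sample where the deviation of
the corresponding clipped margin is controlled. -/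
lemma misclassProb_le_of_deviation {dx dh K T : ℕ} {B : LSTMNormBounds} {Bx : ℝ} (hBx : 0 ≤ Bx)
    (hK : 2 ≤ K) {ρ : ℝ≥0} {σy : ℝ → ℝ} (hσ : LipschitzWith ρ σy) (hσ0 : σy 0 = 0)
    {φ : EuclideanSpace ℝ (Fin K) → Fin K}
    (hφ : ∀ (y : EuclideanSpace ℝ (Fin K)) (j : Fin K), y j ≤ y (φ y))
    {t : ℕ} (ht1 : 1 ≤ t) (ht : t ≤ T) (D : Measure (LabeledSeq dx K T)) [IsProbabilityMeasure D]
    {m : ℕ} (hm : 0 < m) {δ : ℝ} (hδ0 : 0 < δ) (hδ1 : δ < 1) {S : Fin m → LabeledSeq dx K T}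
    (hS : ∀ j, ∀ i : Fin T, ‖(S j i).1‖ ≤ Bx) {γ : ℝ} (hγ : 0 < γ) {w : LSTMWeights dx dh K}
    (hw : w ∈ lstmClass B dx dh K) {N a ε Γ : ℝ} (hN : 1 ≤ N)
    (hNa : Real.log N ≤ a * ((max dx (max K dh) : ℕ) : ℝ) ^ 2 *
      Real.log (geomRatio (lstmTheta B Bx t w) t * ((max dx (max K dh) : ℕ) : ℝ) * √(m : ℝ)))
    (hΛ : 1 / 2 ≤
      Real.log (geomRatio (lstmTheta B Bx t w) t * ((max dx (max K dh) : ℕ) : ℝ) * √(m : ℝ)))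
    (hε0 : 0 ≤ ε) (hε : ε ≤ ρ * B.V * hiddenBound B Bx t w / √(m : ℝ))
    (hΓ : 2 * (ρ * B.V * hiddenBound B Bx t w) ≤ Γ)
    (hdev : (1 / (m : ℝ)) * ∑ j, clippedMargin σy t (w, min γ Γ) (inputPrefix t ht (S j))
        (labelAt t ht1 ht (S j)) -
      ∫ p, clippedMargin σy t (w, min γ Γ) (inputPrefix t ht p) (labelAt t ht1 ht p) ∂D ≤
        2 * ε + (min (min γ Γ) (2 * (ρ * B.V * hiddenBound B Bx t w)) + 2 * ε) *
          √(Real.log (N / δ) / (2 * m))) :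
    misclassProb σy φ t ht1 ht D w ≤
      empRampRisk σy γ t ht1 ht S w + 3 * √(Real.log (2 / δ) / (2 * m)) +
        (4 + 4 * √(a / 2)) * lstmRate B Bx ρ t m γ w := by
  have hK1 : 1 ≤ K := by omega
  have hrate := lstmRate_nonneg hBx ρ ht1 m hγ hK1 hw
  have hR := empRampRisk_nonneg (σy := σy) hγ ht1 ht S w
  have hP := misclassProb_le_one σy φ ht1 ht D w
  have hcr : 0 ≤ (4 + 4 * √(a / 2)) * lstmRate B Bx ρ t m γ w := mul_nonneg (by positivity) hrate
  -- Otherwise the right side is already at least `1`.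
  by_cases hs : 3 * √(Real.log (2 / δ) / (2 * m)) < 1
  · have hh := hiddenBound_nonneg hBx ht1 hK1 hw
    have hV : 0 ≤ B.V := (norm_nonneg _).trans hw.2.2.2.2.2.2.2.2
    set v := ρ * B.V * hiddenBound B Bx t w with hv
    have hv0 : 0 ≤ v := by positivity
    have hΓ0 : 0 ≤ Γ := by linarith
    have hmar : ∀ j, margin (lstmOutput σy w t (inputPrefix t ht (S j)))
        (labelAt t ht1 ht (S j)) ≤ Γ := fun j =>
      ((le_abs_self _).trans (abs_margin_lstmOutput_le hBx hσ hσ0 hw t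
        (fun i => hS j _) _)).trans hΓ
    have h1 := misclassProb_le hσ.continuous hφ ht1 ht D hγ (le_min hγ.le hΓ0) (min_le_left γ Γ) w
    have h2 := empRampRisk_eq hγ ht1 ht hm hΓ0 hmar
    have hd : (2 : ℝ) ≤ ((max dx (max K dh) : ℕ) : ℝ) := by
      exact_mod_cast le_max_of_le_right (le_max_of_le_left hK)
    have h3 := deviation_le_rate (v := v / γ) (e := ε / γ)
      (b := min (min γ Γ) (2 * v) / γ) hd (by exact_mod_cast hm : (1 : ℝ) ≤ m) (by positivity) hΛ hN
      hNa (by positivity)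
      (by rw [div_right_comm]; exact div_le_div_of_nonneg_right hε hγ.le)
      (div_nonneg (le_min (le_min hγ.le hΓ0) (by positivity)) hγ.le)
      (by rw [← mul_div_assoc]; exact div_le_div_of_nonneg_right (min_le_right _ _) hγ.le)
      (by rw [div_le_one hγ]; exact (min_le_left _ _).trans (min_le_left _ _)) hδ0 hδ1 hs
    rw [lstmRate_eq]
    have h4 := div_le_div_of_nonneg_right hdev hγ.le
    rw [sub_div] at h4
    have h5 : (2 * ε + (min (min γ Γ) (2 * v) + 2 * ε) * √(Real.log (N / δ) / (2 * m))) / γ =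
        2 * (ε / γ) + (min (min γ Γ) (2 * v) / γ + 2 * (ε / γ)) *
          √(Real.log (N / δ) / (2 * m)) := by
      ring
    rw [h5] at h4
    linarith
  · linarith

end

/-! ### Assembly of the generalization bound -/

theorem theorem5 :
    ∃ C : ℝ, 0 < C ∧
      ∀ (B : LSTMNormBounds) (Bx : ℝ) (ρy : ℝ≥0) (t : ℕ) (ht1 : 1 ≤ t),
        ∃ (C' : ℝ) (m₀ : ℕ),
          ∀ (dx dh K T : ℕ) (_hK : 2 ≤ K) (ht : t ≤ T)
            (σy : ℝ → ℝ) (_hσ : LipschitzWith ρy σy) (_hσ0 : σy 0 = 0)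
            (φ : EuclideanSpace ℝ (Fin K) → Fin K) (_hφ : ∀ (y : EuclideanSpace ℝ (Fin K)) (j : Fin K), y j ≤ y (φ y))
            (D : Measure (LabeledSeq dx K T)) (_hD : IsProbabilityMeasure D)
            (_hBx : ∀ᵐ (p : LabeledSeq dx K T) ∂D, ∀ i : Fin T, ‖(p i).1‖ ≤ Bx)
            (m : ℕ) (_hm : 0 < m) (δ : ℝ) (_hδ0 : 0 < δ) (_hδ1 : δ < 1),
            (Measure.pi fun _ : Fin m => D)
                {S : Fin m → LabeledSeq dx K T |
                  ¬ ∀ γ : ℝ, 0 < γ → ∀ w ∈ lstmClass B dx dh K,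
                    misclassProb σy φ t ht1 ht D w ≤
                        empRampRisk σy γ t ht1 ht S w + 3 * √(Real.log (2 / δ) / (2 * m)) +
                          C' * lstmRate B Bx ρy t m γ w ∧
                    (m₀ ≤ m →
                      misclassProb σy φ t ht1 ht D w ≤
                        empRampRisk σy γ t ht1 ht S w + 3 * √(Real.log (2 / δ) / (2 * m)) +
                          C * lstmRate B Bx ρy t m γ w)} ≤
              ENNReal.ofReal δ := by
  -- The value `4 + 4 √(a / 2)` at `a = 30`, the large-sample constant of `log_cover_le`.
  refine ⟨4 + 4 * √(30 / 2), by positivity, ?_⟩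
  intro B Bx ρy t ht1
  -- The cover needs a positive resolution `ρy B.V min 1 (B.Wc Bx) / √m`; this fails exactly when
  -- some margin factor degenerates.
  by_cases hpos : 0 < ρy ∧ 0 < B.V ∧ 0 ≤ Bx ∧ 0 < B.Wc * Bx
  · obtain ⟨hρ, hV, hBx, hM⟩ := hpos
    have hμ : 0 < min 1 (B.Wc * Bx) := lt_min one_pos hM
    obtain ⟨k₀, hk₀, hcov⟩ := exists_clippedMargin_cover B Bx t hBx hV hμ
    -- The threshold ensures `k₀ ≤ √m`.
    refine ⟨4 + 4 * √(20 * (Real.log k₀ + 1) / 2), ⌈k₀ ^ 2⌉₊, ?_⟩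
    intro dx dh K T hK ht σy hσ hσ0 φ hφ D hD hDBx m hm δ hδ0 hδ1
    set d : ℕ := max dx (max K dh) with hd
    have hdx : dx ≤ d := le_max_left _ _
    have hdh : dh ≤ d := le_max_of_le_right (le_max_right _ _)
    have hdK : K ≤ d := le_max_of_le_right (le_max_left _ _)
    have hd2 : 2 ≤ d := hK.trans hdK
    obtain ⟨C, hC1, hC2, hC3⟩ := hcov dx dh K d m ρy σy hdx hdh hdK (by omega) hm hρ hσ
    have hρ' : (0 : ℝ) < ρy := hρ
    have hmR : (0 : ℝ) < m := by exact_mod_cast hm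
    have hm1 : (1 : ℝ) ≤ √(m : ℝ) := by
      rw [Real.one_le_sqrt]
      exact_mod_cast hm
    have hd0 : (0 : ℝ) < d := by exact_mod_cast (by omega : 0 < d)
    have hd1 : (1 : ℝ) ≤ d := by exact_mod_cast (by omega : 1 ≤ d)
    set N : ℝ := (k₀ * ((d : ℝ) ^ 2 * √(m : ℝ))) ^ (10 * d ^ 2) with hNdef
    have hN : 1 ≤ N := one_le_pow₀ (one_le_mul_of_one_le_of_one_le (by linarith)
      (one_le_mul_of_one_le_of_one_le (one_le_pow₀ hd1) hm1))
    set Γ : ℝ := 2 * (ρy * B.V * √(d : ℝ)) with hΓ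
    set ε : ℝ := ρy * B.V * min 1 (B.Wc * Bx) / √(m : ℝ) with hε
    have hε0 : 0 < ε := by positivity
    have hdev := uniform_deviation D (A := {p | ∀ i : Fin T, ‖(p i).1‖ ≤ Bx}) hDBx
      (F := fun (i : LSTMWeights dx dh K × ℝ) p =>
        clippedMargin σy t i (inputPrefix t ht p) (labelAt t ht1 ht p))
      (measurable_clippedMargin_seq hσ.continuous ht1 ht)
      (P := {i | i.1 ∈ lstmClass B dx dh K ∧ 0 ≤ i.2 ∧ i.2 ≤ Γ})
      -- The range of each function involves the `β` of its own network.
      (b := fun i => min i.2 (2 * (ρy * B.V * hiddenBound B Bx t i.1)))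
      (fun i hi p _ => clippedMargin_nonneg hi.2.1 _ _)
      (fun i hi p hp => by
        have h1 := (abs_nonneg _).trans (abs_margin_lstmOutput_le hBx hσ hσ0 hi.1 t
          (X := inputPrefix t ht p) (fun j => hp _) (labelAt t ht1 ht p))
        exact min_le_min_left _ (max_le ((le_abs_self _).trans
          (abs_margin_lstmOutput_le hBx hσ hσ0 hi.1 t (fun j => hp _) _)) h1))
      hε0 hC1
      (fun i hi => by
        obtain ⟨c, hc, h⟩ := hC3 i hi.1 hi.2.1 hi.2.2
        exact ⟨c, hc, fun p hp => h _ (fun j => hp _) _⟩)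
      hN hC2 hm hδ0 hδ1
    refine (measure_mono ?_).trans hdev
    intro S hS hgood
    refine hS ?_
    obtain ⟨hSA, hgood⟩ := hgood
    intro γ hγ w hw
    have hlog := log_cover_le hk₀ hd2 hm (log_le_log_rate (Bx := Bx) ht1 hw hd0
      (by linarith : 0 < √(m : ℝ)))
    have hhid : hiddenBound B Bx t w ≤ √(d : ℝ) := min_le_left _ _
    have hΓw : 2 * (ρy * B.V * hiddenBound B Bx t w) ≤ Γ := by
      rw [hΓ]
      gcongr
    have hεw : ε ≤ ρy * B.V * hiddenBound B Bx t w / √(m : ℝ) := by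
      rw [hε]
      gcongr
      exact hiddenBound_ge hBx ht1 (by omega) hw
    have hΓ0 : 0 ≤ Γ := by positivity
    have hdevw := hgood (w, min γ Γ) ⟨hw, le_min hγ.le hΓ0, min_le_right _ _⟩
    have key : ∀ a : ℝ, Real.log N ≤ a * (d : ℝ) ^ 2 *
        Real.log (geomRatio (lstmTheta B Bx t w) t * (d : ℝ) * √(m : ℝ)) →
        misclassProb σy φ t ht1 ht D w ≤
          empRampRisk σy γ t ht1 ht S w + 3 * √(Real.log (2 / δ) / (2 * m)) +
            (4 + 4 * √(a / 2)) * lstmRate B Bx ρy t m γ w := fun a hNa =>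
      misclassProb_le_of_deviation hBx hK hσ hσ0 hφ ht1 ht D hm hδ0 hδ1 hSA hγ hw hN hNa
        hlog.2.2 hε0.le hεw hΓw hdevw
    refine ⟨key _ hlog.1, fun hm₀ => key _ (hlog.2.1 ?_)⟩
    apply Real.le_sqrt_of_sq_le
    exact (Nat.le_ceil _).trans (by exact_mod_cast hm₀)
  · refine ⟨0, 0, ?_⟩
    intro dx dh K T hK ht σy hσ hσ0 φ hφ D hD hDBx m hm δ hδ0 hδ1
    have hBx : 0 ≤ Bx := by
      obtain ⟨p, hp⟩ := hDBx.exists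
      exact (norm_nonneg _).trans (hp ⟨0, by omega⟩)
    have hae : ∀ᵐ S ∂(Measure.pi fun _ : Fin m => D), ∀ j, ∀ i : Fin T, ‖(S j i).1‖ ≤ Bx := by
      rw [ae_all_iff]
      intro j
      exact (Measure.quasiMeasurePreserving_eval (fun _ : Fin m => D) j).ae hDBx
    refine (measure_mono ?_).trans ((ae_iff.mp hae).le.trans bot_le)
    intro S hS hSA
    refine hS ?_
    intro γ hγ w hw
    have hWc0 : 0 ≤ B.Wc := (norm_nonneg _).trans hw.2.2.2.1
    have hV0 : 0 ≤ B.V := (norm_nonneg _).trans hw.2.2.2.2.2.2.2.2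
    -- Membership of `w` in the class makes `B.V` and `B.Wc` nonnegative, so the failure of `hpos`
    -- forces one factor to vanish.
    have hdeg : (ρy : ℝ) * B.V * hiddenBound B Bx t w = 0 := by
      by_contra hne
      refine hpos ⟨?_, ?_, hBx, ?_⟩
      · exact pos_iff_ne_zero.mpr fun h => hne (by simp [h])
      · exact lt_of_le_of_ne hV0 fun h => hne (by simp [← h])
      · refine lt_of_le_of_ne (mul_nonneg hWc0 hBx) fun h => hne ?_
        rw [hiddenBound, ← h, zero_mul, min_eq_right (Real.sqrt_nonneg _), mul_zero]
    have hR := empRampRisk_eq_one_of_degenerate hBx hσ hσ0 hw ht1 ht hdeg hm hγ hSA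
    have hP := misclassProb_le_one σy φ ht1 ht D w
    have hrate := lstmRate_nonneg hBx ρy ht1 m hγ (by omega) hw
    have hs : 0 ≤ √(Real.log (2 / δ) / (2 * m)) := Real.sqrt_nonneg _
    rw [hR]
    refine ⟨by linarith, fun _ => ?_⟩
    have : 0 ≤ (4 + 4 * √(30 / 2)) * lstmRate B Bx ρy t m γ w :=
      mul_nonneg (by positivity) hrate
    linarith
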